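/- **Theorem 2.1.** Let $1<p\le 2$, $K\ge 1$ and $0<\tau_1<\dots<\tau_K<1$. For $s\in\mathbb R$ put $$\eta_{\tau,p}(s)=|\tau-I(s<0)|\,|s|^{p},\qquad \varphi_{\tau,p}(s)=p\,|\tau-I(s<0)|\,|s|^{p-1}\operatorname{sign}(s),\qquad \psi_{\tau,p}(s)=p(p-1)\,|\tau-I(s<0)|\,|s|^{p-2}.$$ Consider the linear model $y_t=\mathbf x_t'\beta^*+\varepsilon_t$, $t=1,2,\dots$, with $\beta^*\in\mathbb R^m$, with non-random predictors $\mathbf x_t\in\mathbb R^m$ that are centered, in the sense that $\frac1T\sum_{t=1}^T\mathbf x_t\to 0$ as $T\to\infty$, and with i.i.d. errors $\varepsilon_t$ distributed as $\varepsilon$. Let $b^*_{\tau}$ denote the $\tau$-th $L^p$-quantile of $\varepsilon$, that is, a minimizer of $b\mapsto E[\eta_{\tau,p}(\varepsilon-b)-\eta_{\tau,p}(\varepsilon)]$. For each $T$ let $\hat\beta^{clp}$ be the (measurable) composite $L^p$-quantile regression estimator given by $$(\hat b_1,\dots,\hat b_K,\hat\beta^{clp})\in\operatorname*{arg\,min}_{b_1,\dots,b_K\in\mathbb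 R,\ \beta\in\mathbb R^m}\ \sum_{k=1}^K\sum_{t=1}^T\eta_{\tau_k,p}(y_t-b_k-\mathbf x_t'\beta).$$ Assume: 1. $\frac1T\mathbf X'\mathbf X\to \mathbf C$ as $T\to\infty$ for a positive definite $m\times m$ matrix $\mathbf C$, where $\mathbf X=(\mathbf x_1,\dots,\mathbf x_T)'$; 2. $E|\varepsilon|^{2(p-1)}<\infty$; 3. there is $\delta>0$ such that $E|\varepsilon-b|^{p-2}<\infty$ for every $k$ and every $b$ with $|b-b^*_{\tau_k}|<\delta$ (for $p<2$, $|0|^{p-2}=\infty$; for $p=2$, $|0|^{0}=1$); and, if $p=2$, $P(\varepsilon=b^*_{\tau_k})=0$ for every $k$ with $\tau_k\neq\frac12$ (for $p<2$ the first part already excludes atoms at the $b^*_{\tau_k}$). Then the expectations below are finite, the sum in the denominator is positive, and $\sqrt T(\hat\beta^{clp}-\beta^*)$ converges in distribution, as $T\to\infty$, to the normal distribution on $\mathbb R^m$ with mean $0$ and covariance matrix $$\boldsymbol\Sigma_{clp}=\mathbf C^{-1}\,\frac{\sum_{k'=1}^K\sum_{k=1}^K E\big[\varphi_{\tau_{k'},p}(\varepsilon-b^*_{\tau_{k'}})\,\varphi_{\tau_k,p}(\varepsilon-b^*_{\tau_k})\big]}{\Big(\sum_{k=1}^K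 E\,\psi_{\tau_k,p}(\varepsilon-b^*_{\tau_k})\Big)^{2}}.$$ -/

import Mathlib

open Filter Topology MeasureTheory ProbabilityTheory

noncomputable section

namespace CLpQR

/-- The asymmetric weight `|τ - I(s < 0)|`. -/
def weight (τ s : ℝ) : ℝ := |τ - if s < 0 then 1 else 0|

/-- The `L^p`-quantile loss `η_{τ,p}(s) = |τ - I(s < 0)| |s|^p`. -/
def eta (τ p s : ℝ) : ℝ := weight τ s * |s| ^ p

/-- `φ_{τ,p}(s) = p |τ - I(s < 0)| |s|^{p-1} sign(s)`. -/
def phi (τ p s : ℝ) : ℝ := p * weight τ s * |s| ^ (p - 1) * Real.sign s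

/-- `ψ_{τ,p}(s) = p (p-1) |τ - I(s < 0)| |s|^{p-2}`. -/
def psi (τ p s : ℝ) : ℝ := p * (p - 1) * weight τ s * |s| ^ (p - 2)

/-- `b` is a `τ`-th `L^p`-quantile of the law `ν` on the real line: it minimizes
`b' ↦ E[η_{τ,p}(ε - b') - η_{τ,p}(ε)]` for `ε ∼ ν`. Subtracting `η_{τ,p}(ε)` does not change the
minimizers when `E|ε|^p < ∞`, and it makes the expectation finite as soon as
`E|ε|^{p-1} < ∞`. -/
def IsLpQuantile (ν : Measure ℝ) (p τ b : ℝ) : Prop :=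
  ∀ b' : ℝ, ∫ s, (eta τ p (s - b) - eta τ p s) ∂ν ≤ ∫ s, (eta τ p (s - b') - eta τ p s) ∂ν

/-- The composite `L^p`-quantile objective
`∑ₖ ∑ₜ η_{τₖ,p}(yₜ - bₖ - xₜ'β)` over the first `T` observations. -/
def objective {m K : ℕ} (p : ℝ) (τ : Fin K → ℝ) (x : ℕ → EuclideanSpace ℝ (Fin m)) (y : ℕ → ℝ)
    (T : ℕ) (b : Fin K → ℝ) (β : EuclideanSpace ℝ (Fin m)) : ℝ :=
  ∑ k : Fin K, ∑ t ∈ Finset.range T, eta (τ k) p (y t - b k - inner ℝ (x t) β)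

/-- `(b, β)` is a composite `L^p`-quantile regression fit to the first `T` observations: a
minimizer of the objective over all intercepts and all slopes jointly. -/
def IsCLpQRFit {m K : ℕ} (p : ℝ) (τ : Fin K → ℝ) (x : ℕ → EuclideanSpace ℝ (Fin m)) (y : ℕ → ℝ)
    (T : ℕ) (b : Fin K → ℝ) (β : EuclideanSpace ℝ (Fin m)) : Prop :=
  ∀ (b' : Fin K → ℝ) (β' : EuclideanSpace ℝ (Fin m)),
    objective p τ x y T b β ≤ objective p τ x y T b' β'

/-- The `T × m` design matrix, with rows the first `T` predictors. -/
def designMatrix {m : ℕ} (x : ℕ → EuclideanSpace ℝ (Fin m)) (T : ℕ) : Matrix (Fin T) (Fin m) ℝ :=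
  Matrix.of fun t j => x t j

/-- `∑ₖ' ∑ₖ E[φ_{τₖ',p}(ε - b_{k'}) φ_{τₖ,p}(ε - b_k)]`, for `ε ∼ ν`. -/
def scoreVar {K : ℕ} (ν : Measure ℝ) (p : ℝ) (τ b : Fin K → ℝ) : ℝ :=
  ∑ k' : Fin K, ∑ k : Fin K, ∫ s, phi (τ k') p (s - b k') * phi (τ k) p (s - b k) ∂ν

/-- `∑ₖ E ψ_{τₖ,p}(ε - b_k)`, for `ε ∼ ν`. -/
def curvature {K : ℕ} (ν : Measure ℝ) (p : ℝ) (τ b : Fin K → ℝ) : ℝ :=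
  ∑ k : Fin K, ∫ s, psi (τ k) p (s - b k) ∂ν

/-- The asymptotic covariance matrix
`C⁻¹ (∑ₖ' ∑ₖ E[φ_{τₖ'} φ_{τₖ}]) / (∑ₖ E ψ_{τₖ})²`. -/
def asympCov {m K : ℕ} (C : Matrix (Fin m) (Fin m) ℝ) (ν : Measure ℝ) (p : ℝ)
    (τ b : Fin K → ℝ) : Matrix (Fin m) (Fin m) ℝ :=
  (scoreVar ν p τ b / curvature ν p τ b ^ 2) • C⁻¹

end CLpQR

end

/-!
The proof is the convexity argument for minimizers of random convex functions. With the local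
parameter `θ = (u, v) = √T ((b, β) - (b*, β*))` and the shifts `hₜ = (u_k + xₜ'v) / √T`, the
objective is, up to a constant, `remainderSum - scoreSum`: the linear term `scoreSum` collects the
scores `φ(εₜ - b*_k) hₜ`, and the term `remainderSum` collects
`R(e, h) = η(e - h) - η(e) + φ(e) h`.

The remainder `R(e, ·)` is convex and nonnegative, and two bounds control it. Since `φ` is Hölder
of order `p - 1`, `R(e, h) ≤ 2 p |h| ^ p` (`remainder_le`), so the variance of `remainderSum` is of
order `∑ |hₜ| ^ (2 p)`, which vanishes because `p > 1`, `∑ hₜ ^ 2` converges and `max |hₜ| → 0`.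
Also `R(e, h) ≤ 8 p |e| ^ (p - 2) h ^ 2` (`remainder_le_sq`), so dominated convergence gives
`E R(ε - b, h) / h ^ 2 → E ψ(ε - b) / 2` (`tendsto_integral_remainder_div_sq`). Hence `remainderSum`
converges in probability, at each `θ`, to the quadratic form `quadLimit`; as the predictors are
centered, `quadLimit` has no cross term between intercepts and slopes.

Closeness of a nonnegative convex function to its limit on a finite net is uniform closeness on a
ball (`exists_finset_abs_sub_le_of_convexOn`). The minimizer `center` of `quadLimit - scoreSum` is
bounded in probability by Chebyshev's inequality, so the rescaled estimator is within `o_P(1)` of it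
(`norm_sub_le_of_convexOn_of_isMinOn`). The slope part of `center` is a normalized weighted sum of
the i.i.d. variables `∑ₖ φ(εₜ - b*_k)`, which are centered by the first order condition
(`integral_phi_eq_zero`); a Lindeberg argument on characteristic functions
(`tendsto_charFun_weighted_sum`) and Slutsky's lemma finish the proof.
-/

namespace CLpQR

/-! ### The asymmetric power loss and its second order expansion -/

lemma weight_of_neg {τ s : ℝ} (hτ : τ < 1) (hs : s < 0) : weight τ s = 1 - τ := by
  rw [weight, if_pos hs, abs_of_neg (by linarith)]; ring

lemma weight_of_nonneg {τ s : ℝ} (hτ : 0 < τ) (hs : 0 ≤ s) : weight τ s = τ := by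
  rw [weight, if_neg hs.not_gt, sub_zero, abs_of_pos hτ]

section Weight

variable {τ : ℝ} (h0 : 0 < τ) (h1 : τ < 1)
include h0 h1

lemma weight_pos (s : ℝ) : 0 < weight τ s := by
  rcases lt_or_ge s 0 with h | h
  · rw [weight_of_neg h1 h]; linarith
  · rwa [weight_of_nonneg h0 h]

lemma weight_le_one (s : ℝ) : weight τ s ≤ 1 := by
  rcases lt_or_ge s 0 with h | h
  · rw [weight_of_neg h1 h]; linarith
  · rw [weight_of_nonneg h0 h]; linarith

lemma eventually_weight_eq {s : ℝ} (hs : s ≠ 0) : ∀ᶠ r in 𝓝 s, weight τ r = weight τ s := by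
  rcases hs.lt_or_gt with h | h
  · filter_upwards [gt_mem_nhds h] with r hr
    rw [weight_of_neg h1 h, weight_of_neg h1 hr]
  · filter_upwards [lt_mem_nhds h] with r hr
    rw [weight_of_nonneg h0 h.le, weight_of_nonneg h0 hr.le]

end Weight

lemma phi_zero {τ p : ℝ} : phi τ p 0 = 0 := by simp [phi]

section Loss

variable {τ p : ℝ} (h0 : 0 < τ) (h1 : τ < 1) (hp1 : 1 < p)

include h0 in
lemma phi_of_nonneg {s : ℝ} (hp1 : 1 < p) (hs : 0 ≤ s) : phi τ p s = p * τ * s ^ (p - 1) := by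
  rcases hs.eq_or_lt with rfl | hs
  · rw [phi_zero, Real.zero_rpow (by linarith), mul_zero]
  · rw [phi, weight_of_nonneg h0 hs.le, abs_of_pos hs, Real.sign_of_pos hs, mul_one]

include h1 in
lemma phi_of_nonpos {s : ℝ} (hp1 : 1 < p) (hs : s ≤ 0) :
    phi τ p s = -(p * (1 - τ) * (-s) ^ (p - 1)) := by
  rcases hs.eq_or_lt with rfl | hs
  · rw [phi_zero, neg_zero, Real.zero_rpow (by linarith), mul_zero, neg_zero]
  · rw [phi, weight_of_neg h1 hs, abs_of_neg hs, Real.sign_of_neg hs]; ring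

include h0 h1 hp1

lemma abs_phi_le (s : ℝ) : |phi τ p s| ≤ p * |s| ^ (p - 1) := by
  have hs : |Real.sign s| ≤ 1 := by rcases Real.sign_apply_eq s with h | h | h <;> simp [h]
  have hr : 0 ≤ |s| ^ (p - 1) := by positivity
  have hw := weight_pos h0 h1 s
  rw [phi, abs_mul, abs_mul, abs_mul, abs_of_pos hw, abs_of_pos (by linarith : 0 < p),
    abs_of_nonneg hr]
  calc p * weight τ s * |s| ^ (p - 1) * |Real.sign s| ≤ p * 1 * |s| ^ (p - 1) * 1 := by
        gcongr
        exact weight_le_one h0 h1 s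
    _ = _ := by ring

lemma hasDerivAt_eta (s : ℝ) : HasDerivAt (eta τ p) (phi τ p s) s := by
  rcases eq_or_ne s 0 with rfl | hs
  · have h := hasDerivAt_abs_rpow 0 hp1
    rw [phi_zero]
    rw [mul_zero, hasDerivAt_iff_isLittleO_nhds_zero] at h
    rw [hasDerivAt_iff_isLittleO_nhds_zero]
    refine (Asymptotics.IsBigO.of_bound 1 (Eventually.of_forall fun r => ?_)).trans_isLittleO h
    have hz : (0 : ℝ) ^ p = 0 := Real.zero_rpow (by linarith)
    have hr : 0 ≤ |r| ^ p := by positivity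
    simp only [eta, zero_add, abs_zero, hz, mul_zero, smul_zero, sub_zero, one_mul]
    rw [norm_mul, Real.norm_of_nonneg (weight_pos h0 h1 r).le]
    exact mul_le_of_le_one_left (norm_nonneg _) (weight_le_one h0 h1 r)
  · have h := (hasDerivAt_abs_rpow s hp1).const_mul (weight τ s)
    have hval : weight τ s * (p * |s| ^ (p - 2) * s) = phi τ p s := by
      have e : |s| ^ (p - 1) = |s| ^ (p - 2) * |s| := by
        rw [← Real.rpow_add_one (abs_ne_zero.2 hs)]; ring_nf
      have e2 : |s| * Real.sign s = s := by
        rcases hs.lt_or_gt with h | h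
        · rw [abs_of_neg h, Real.sign_of_neg h]; ring
        · rw [abs_of_pos h, Real.sign_of_pos h]; ring
      rw [phi, e]
      linear_combination (-(p * weight τ s * |s| ^ (p - 2))) * e2
    rw [hval] at h
    refine h.congr_of_eventuallyEq ?_
    filter_upwards [eventually_weight_eq h0 h1 hs] with r hr
    rw [eta, hr]

lemma hasDerivAt_phi {s : ℝ} (hs : s ≠ 0) : HasDerivAt (phi τ p) (psi τ p s) s := by
  rcases hs.lt_or_gt with h | h
  · have h3 : HasDerivAt (fun r : ℝ => -(p * (1 - τ) * (-r) ^ (p - 1))) (psi τ p s) s := by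
      have := (((hasDerivAt_neg s).rpow_const (p := p - 1) (Or.inl (by linarith))).const_mul
        (p * (1 - τ))).neg
      refine this.congr_deriv ?_
      rw [psi, weight_of_neg h1 h, abs_of_neg h]
      ring_nf
    refine h3.congr_of_eventuallyEq ?_
    filter_upwards [gt_mem_nhds h] with r hr
    exact phi_of_nonpos h1 hp1 hr.le
  · have h3 : HasDerivAt (fun r : ℝ => p * τ * r ^ (p - 1)) (psi τ p s) s := by
      have := ((hasDerivAt_id s).rpow_const (p := p - 1) (Or.inl hs)).const_mul (p * τ)
      refine this.congr_deriv ?_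
      rw [psi, weight_of_nonneg h0 h.le, abs_of_pos h]
      simp only [id]
      ring_nf
    refine h3.congr_of_eventuallyEq ?_
    filter_upwards [lt_mem_nhds h] with r hr
    exact phi_of_nonneg h0 hp1 hr.le

lemma monotone_phi : Monotone (phi τ p) := by
  have hp : 0 < p := by linarith
  have hτ : 0 < 1 - τ := by linarith
  intro a b hab
  rcases le_total 0 a with ha | ha
  · rw [phi_of_nonneg h0 hp1 ha, phi_of_nonneg h0 hp1 (ha.trans hab)]
    have : a ^ (p - 1) ≤ b ^ (p - 1) := Real.rpow_le_rpow ha hab (by linarith)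
    gcongr
  rcases le_total 0 b with hb | hb
  · rw [phi_of_nonpos h1 hp1 ha, phi_of_nonneg h0 hp1 hb]
    have h2 : 0 ≤ (-a) ^ (p - 1) := Real.rpow_nonneg (by linarith) _
    have h3 : 0 ≤ b ^ (p - 1) := Real.rpow_nonneg hb _
    have : 0 ≤ p * (1 - τ) * (-a) ^ (p - 1) := by positivity
    have : 0 ≤ p * τ * b ^ (p - 1) := by positivity
    linarith
  · rw [phi_of_nonpos h1 hp1 ha, phi_of_nonpos h1 hp1 hb, neg_le_neg_iff]
    have : (-b) ^ (p - 1) ≤ (-a) ^ (p - 1) :=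
      Real.rpow_le_rpow (by linarith) (by linarith) (by linarith)
    gcongr

lemma convexOn_eta : ConvexOn ℝ Set.univ (eta τ p) := by
  have hd : deriv (eta τ p) = phi τ p := funext fun s => (hasDerivAt_eta h0 h1 hp1 s).deriv
  refine Monotone.convexOn_univ_of_deriv (fun s => (hasDerivAt_eta h0 h1 hp1 s).differentiableAt) ?_
  rw [hd]
  exact monotone_phi h0 h1 hp1

lemma phi_sub_le_of_le (hp2 : p ≤ 2) {a b : ℝ} (hab : a ≤ b) :
    phi τ p b - phi τ p a ≤ 2 * p * (b - a) ^ (p - 1) := by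
  have hp : 0 < p := by linarith
  have hq : 0 ≤ p - 1 := by linarith
  have hq1 : p - 1 ≤ 1 := by linarith
  have hba : 0 ≤ b - a := by linarith
  have hr : 0 ≤ (b - a) ^ (p - 1) := Real.rpow_nonneg hba _
  have hτ : 0 < 1 - τ := by linarith
  have aux : ∀ {w c d : ℝ}, 0 < w → w < 1 → 0 ≤ c → c ≤ d →
      p * w * d ^ (p - 1) - p * w * c ^ (p - 1) ≤ 2 * p * (d - c) ^ (p - 1) := by
    intro w c d hw hw1 hc hcd
    have h := Real.rpow_add_le_add_rpow (sub_nonneg.2 hcd) hc hq hq1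
    rw [sub_add_cancel] at h
    have hn : 0 ≤ (d - c) ^ (p - 1) := Real.rpow_nonneg (by linarith) _
    calc p * w * d ^ (p - 1) - p * w * c ^ (p - 1)
        = p * (w * (d ^ (p - 1) - c ^ (p - 1))) := by ring
      _ ≤ p * (1 * (d - c) ^ (p - 1)) := by
          have : c ^ (p - 1) ≤ d ^ (p - 1) := Real.rpow_le_rpow hc hcd hq
          gcongr ?_ * (?_ * ?_)
          · linarith
      _ ≤ _ := by nlinarith [mul_nonneg hp.le hn]
  rcases le_total 0 a with ha | ha
  · rw [phi_of_nonneg h0 hp1 ha, phi_of_nonneg h0 hp1 (ha.trans hab)]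
    exact aux h0 h1 ha hab
  rcases le_total 0 b with hb | hb
  · rw [phi_of_nonpos h1 hp1 ha, phi_of_nonneg h0 hp1 hb]
    have h2 : (-a) ^ (p - 1) ≤ (b - a) ^ (p - 1) :=
      Real.rpow_le_rpow (by linarith) (by linarith) hq
    have h3 : b ^ (p - 1) ≤ (b - a) ^ (p - 1) := Real.rpow_le_rpow hb (by linarith) hq
    calc p * τ * b ^ (p - 1) - -(p * (1 - τ) * (-a) ^ (p - 1))
        = p * τ * b ^ (p - 1) + p * (1 - τ) * (-a) ^ (p - 1) := by ring
      _ ≤ p * τ * (b - a) ^ (p - 1) + p * (1 - τ) * (b - a) ^ (p - 1) := by gcongr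
      _ ≤ _ := by nlinarith [mul_nonneg hp.le hr]
  · rw [phi_of_nonpos h1 hp1 ha, phi_of_nonpos h1 hp1 hb]
    have := aux hτ (by linarith) (neg_nonneg.2 hb) (neg_le_neg hab)
    rw [show -a - -b = b - a by ring] at this
    linarith

/-- The score is globally Hölder continuous with exponent `p - 1`. -/
lemma abs_phi_sub_le (hp2 : p ≤ 2) (a b : ℝ) :
    |phi τ p a - phi τ p b| ≤ 2 * p * |a - b| ^ (p - 1) := by
  wlog hab : b ≤ a generalizing a b
  · rw [abs_sub_comm, abs_sub_comm a]
    exact this b a (le_of_not_ge hab)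
  rw [abs_of_nonneg (sub_nonneg.2 (monotone_phi h0 h1 hp1 hab)), abs_of_nonneg (sub_nonneg.2 hab)]
  exact phi_sub_le_of_le h0 h1 hp1 hp2 hab

end Loss

/-- The error `η(e - h) - η(e) + φ(e) h` of the first order expansion of the loss at `e`. -/
noncomputable def remainder (τ p e h : ℝ) : ℝ := eta τ p (e - h) - eta τ p e + phi τ p e * h

section Remainder

variable {τ p : ℝ} (h0 : 0 < τ) (h1 : τ < 1) (hp1 : 1 < p)

lemma remainder_zero (τ p e : ℝ) : remainder τ p e 0 = 0 := by simp [remainder]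

include h0 h1 hp1

lemma convexOn_remainder (e : ℝ) : ConvexOn ℝ Set.univ (remainder τ p e) := by
  refine ⟨convex_univ, fun x _ y _ a b ha hb hab => ?_⟩
  have h := (convexOn_eta h0 h1 hp1).2 (Set.mem_univ (e - x)) (Set.mem_univ (e - y)) ha hb hab
  simp only [smul_eq_mul, remainder] at h ⊢
  have e1 : a * (e - x) + b * (e - y) = e - (a * x + b * y) := by
    linear_combination e * hab
  rw [e1] at h
  have e2 : b = 1 - a := by linarith
  subst e2
  linarith

lemma hasDerivAt_remainder (e h : ℝ) :
    HasDerivAt (remainder τ p e) (phi τ p e - phi τ p (e - h)) h := by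
  have h2 : HasDerivAt (fun r => eta τ p (e - r)) (phi τ p (e - h) * (-1)) h :=
    (hasDerivAt_eta h0 h1 hp1 (e - h)).comp h ((hasDerivAt_id h).const_sub e)
  have h3 := (h2.sub_const (eta τ p e)).add ((hasDerivAt_id h).const_mul (phi τ p e))
  refine h3.congr_deriv ?_
  ring

/-- The mean value theorem for the remainder. -/
lemma exists_remainder_eq (e h : ℝ) :
    ∃ r, |r| ≤ |h| ∧ 0 ≤ r * h ∧ remainder τ p e h = (phi τ p e - phi τ p (e - r)) * h := by
  have hc : ∀ s : Set ℝ, ContinuousOn (remainder τ p e) s := fun s x _ =>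
    (hasDerivAt_remainder h0 h1 hp1 e x).continuousAt.continuousWithinAt
  rcases lt_trichotomy h 0 with hh | rfl | hh
  · obtain ⟨r, hr, hr2⟩ := exists_hasDerivAt_eq_slope (remainder τ p e) _ hh (hc _)
      fun x _ => hasDerivAt_remainder h0 h1 hp1 e x
    refine ⟨r, ?_, ?_, ?_⟩
    · rw [abs_of_neg hr.2, abs_of_neg hh]; linarith [hr.1]
    · exact mul_nonneg_of_nonpos_of_nonpos hr.2.le hh.le
    · rw [hr2, remainder_zero]; field_simp; ring
  · exact ⟨0, by simp, by simp, by simp [remainder_zero]⟩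
  · obtain ⟨r, hr, hr2⟩ := exists_hasDerivAt_eq_slope (remainder τ p e) _ hh (hc _)
      fun x _ => hasDerivAt_remainder h0 h1 hp1 e x
    refine ⟨r, ?_, ?_, ?_⟩
    · rw [abs_of_pos hr.1, abs_of_pos hh]; linarith [hr.2]
    · exact mul_nonneg hr.1.le hh.le
    · rw [hr2, remainder_zero]; field_simp; ring

lemma remainder_nonneg (e h : ℝ) : 0 ≤ remainder τ p e h := by
  obtain ⟨r, -, hr, he⟩ := exists_remainder_eq h0 h1 hp1 e h
  rw [he]
  rcases lt_trichotomy h 0 with hh | rfl | hh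
  · have : r ≤ 0 := by by_contra hc; nlinarith
    exact mul_nonneg_of_nonpos_of_nonpos
      (sub_nonpos.2 (monotone_phi h0 h1 hp1 (by linarith))) hh.le
  · simp
  · have : 0 ≤ r := by by_contra hc; nlinarith
    exact mul_nonneg (sub_nonneg.2 (monotone_phi h0 h1 hp1 (by linarith))) hh.le

/-- This bound is uniform in `e`; it controls variances. -/
lemma remainder_le (hp2 : p ≤ 2) (e h : ℝ) : remainder τ p e h ≤ 2 * p * |h| ^ p := by
  obtain ⟨r, hr1, -, he⟩ := exists_remainder_eq h0 h1 hp1 e h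
  refine (le_abs_self _).trans ?_
  rw [he, abs_mul]
  rcases eq_or_ne h 0 with rfl | hh
  · have : 0 ≤ |(0 : ℝ)| ^ p := by positivity
    simp only [abs_zero, mul_zero] at this ⊢
    nlinarith
  have e1 : |h| ^ p = |h| ^ (p - 1) * |h| := by
    rw [← Real.rpow_add_one (abs_ne_zero.2 hh)]; ring_nf
  rw [e1, ← mul_assoc]
  gcongr
  refine (abs_phi_sub_le h0 h1 hp1 hp2 _ _).trans ?_
  rw [sub_sub_cancel]
  have hp : 0 < p := by linarith
  have : |r| ^ (p - 1) ≤ |h| ^ (p - 1) := Real.rpow_le_rpow (abs_nonneg _) hr1 (by linarith)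
  gcongr

lemma abs_psi_le (s : ℝ) : |psi τ p s| ≤ p * (p - 1) * |s| ^ (p - 2) := by
  have hw := weight_pos h0 h1 s
  have hr : 0 ≤ |s| ^ (p - 2) := by positivity
  have hp : 0 < p * (p - 1) := mul_pos (by linarith) (by linarith)
  rw [psi, abs_mul, abs_mul, abs_of_pos hp, abs_of_pos hw, abs_of_nonneg hr]
  have := weight_le_one h0 h1 s
  gcongr ?_ * _
  nlinarith

/-- A quadratic bound with an integrable constant: for `|h| ≤ |e| / 2` the loss is twice
differentiable between `e` and `e - h`, and for larger `h` the bound `|h| ^ p` is already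
quadratic up to the factor `|h| ^ (p - 2)`. -/
lemma remainder_le_sq (hp2 : p ≤ 2) {e : ℝ} (he : e ≠ 0) (h : ℝ) :
    remainder τ p e h ≤ 8 * p * |e| ^ (p - 2) * h ^ 2 := by
  have hp : 0 < p := by linarith
  have hepos : 0 < |e| := abs_pos.2 he
  have hhalf : ∀ x : ℝ, |e| / 2 ≤ |x| → |x| ^ (p - 2) ≤ 4 * |e| ^ (p - 2) := by
    intro x hx
    calc |x| ^ (p - 2) ≤ (|e| / 2) ^ (p - 2) :=
          Real.rpow_le_rpow_of_nonpos (by positivity) hx (by linarith)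
      _ = |e| ^ (p - 2) * 2 ^ (2 - p) := by
          rw [Real.div_rpow hepos.le (by norm_num), div_eq_mul_inv, ← Real.rpow_neg (by norm_num)]
          ring_nf
      _ ≤ |e| ^ (p - 2) * 2 ^ (2 : ℝ) := by
          gcongr
          · norm_num
          · linarith
      _ = 4 * |e| ^ (p - 2) := by norm_num; ring
  rcases le_or_gt |h| (|e| / 2) with hh | hh
  · obtain ⟨r, hr1, -, heq⟩ := exists_remainder_eq h0 h1 hp1 e h
    -- `φ` has derivative `ψ` on intervals that stay at distance `|e| / 2` from the origin
    have hlip : ∀ a b : ℝ, (∀ x ∈ Set.Icc a b, |e| / 2 ≤ |x|) → a ≤ b →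
        |phi τ p b - phi τ p a| ≤ p * (p - 1) * (4 * |e| ^ (p - 2)) * (b - a) := by
      intro a b hx hab
      have hne : ∀ x ∈ Set.Icc a b, x ≠ 0 := fun x hxx h => by
        have := hx x hxx; rw [h, abs_zero] at this; linarith
      refine norm_image_sub_le_of_norm_deriv_le_segment' (f := phi τ p) (f' := psi τ p)
        (fun x hxx => (hasDerivAt_phi h0 h1 hp1 (hne x hxx)).hasDerivWithinAt) (fun x hxx => ?_) b
        (Set.right_mem_Icc.2 hab)
      refine (abs_psi_le h0 h1 hp1 x).trans ?_
      have hpp : 0 < p * (p - 1) := mul_pos hp (by linarith)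
      have := hhalf x (hx x ⟨hxx.1, hxx.2.le⟩)
      gcongr
    have hseg : |phi τ p e - phi τ p (e - r)| ≤ p * (p - 1) * (4 * |e| ^ (p - 2)) * |r| := by
      have hre := hr1.trans hh
      rcases le_total 0 r with hr | hr
      · have := hlip (e - r) e ?_ (by linarith)
        · rwa [show e - (e - r) = |r| by rw [abs_of_nonneg hr]; ring] at this
        · rintro x ⟨hx1, hx2⟩
          have h5 : |e - x| ≤ |r| := by
            rw [abs_of_nonneg (by linarith : 0 ≤ e - x), abs_of_nonneg hr]; linarith
          have := abs_sub_abs_le_abs_sub e x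
          linarith
      · have := hlip e (e - r) ?_ (by linarith)
        · rwa [abs_sub_comm, show e - r - e = |r| by rw [abs_of_nonpos hr]; ring] at this
        · rintro x ⟨hx1, hx2⟩
          have h5 : |e - x| ≤ |r| := by
            rw [abs_of_nonpos (by linarith : e - x ≤ 0), abs_of_nonpos hr]; linarith
          have := abs_sub_abs_le_abs_sub e x
          linarith
    have he0 : 0 ≤ |e| ^ (p - 2) := by positivity
    calc remainder τ p e h ≤ |remainder τ p e h| := le_abs_self _
      _ = |phi τ p e - phi τ p (e - r)| * |h| := by rw [heq, abs_mul]
      _ ≤ p * (p - 1) * (4 * |e| ^ (p - 2)) * |r| * |h| := by gcongr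
      _ ≤ p * 1 * (4 * |e| ^ (p - 2)) * |h| * |h| := by gcongr; linarith
      _ = 4 * p * |e| ^ (p - 2) * h ^ 2 := by rw [← sq_abs h]; ring
      _ ≤ 8 * p * |e| ^ (p - 2) * h ^ 2 := by gcongr; norm_num
  · have hhne : |h| ≠ 0 := by linarith
    calc remainder τ p e h ≤ 2 * p * |h| ^ p := remainder_le h0 h1 hp1 hp2 e h
      _ = 2 * p * |h| ^ (p - 2) * h ^ 2 := by
          rw [← sq_abs h, mul_assoc _ (|h| ^ (p - 2)), ← Real.rpow_natCast,
            ← Real.rpow_add (by positivity)]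
          norm_num
      _ ≤ 2 * p * (4 * |e| ^ (p - 2)) * h ^ 2 := by gcongr; exact hhalf h hh.le
      _ = _ := by ring

lemma tendsto_remainder_div_sq {e : ℝ} (he : e ≠ 0) :
    Tendsto (fun h => remainder τ p e h / h ^ 2) (𝓝[≠] 0) (𝓝 (psi τ p e / 2)) := by
  refine HasDerivAt.lhopital_zero_nhdsNE (f := remainder τ p e) (g := fun h => h ^ 2)
    (f' := fun h => phi τ p e - phi τ p (e - h))
    (g' := fun h => 2 * h) (Eventually.of_forall fun x => hasDerivAt_remainder h0 h1 hp1 e x)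
    (Eventually.of_forall fun x => by simpa using hasDerivAt_pow 2 x) ?_ ?_ ?_ ?_
  · filter_upwards [self_mem_nhdsWithin] with x hx
    simpa using hx
  · have := (hasDerivAt_remainder h0 h1 hp1 e 0).continuousAt.tendsto
    rw [remainder_zero] at this
    exact this.mono_left nhdsWithin_le_nhds
  · have : Tendsto (fun h : ℝ => h ^ 2) (𝓝 0) (𝓝 (0 ^ 2)) := (continuous_pow 2).tendsto 0
    rw [zero_pow two_ne_zero] at this
    exact this.mono_left nhdsWithin_le_nhds
  · have hd : HasDerivAt (fun h => phi τ p (e - h)) (psi τ p e * (-1)) 0 := by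
      have h2 : HasDerivAt (phi τ p) (psi τ p e) (e - id 0) := by
        simpa using hasDerivAt_phi h0 h1 hp1 he
      exact h2.comp (0 : ℝ) ((hasDerivAt_id (0 : ℝ)).const_sub e)
    have hs := (hasDerivAt_iff_tendsto_slope.1 hd).const_mul (-1 / 2)
    rw [show -1 / 2 * (psi τ p e * -1) = psi τ p e / 2 by ring] at hs
    refine hs.congr' ?_
    filter_upwards [self_mem_nhdsWithin] with x hx
    have hx : x ≠ 0 := hx
    rw [slope_def_field, sub_zero, sub_zero]
    field_simp
    ring

end Remainder

/-! ### Moments of the score and of the remainder -/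

section Moments

variable {τ p b : ℝ} {ν : Measure ℝ}

lemma measurable_weight (τ : ℝ) : Measurable (weight τ) := by
  unfold weight
  exact ((measurable_const.sub (Measurable.ite measurableSet_Iio measurable_const
    measurable_const))).abs

lemma measurable_psi (τ p : ℝ) : Measurable (psi τ p) := by
  have := measurable_weight τ
  unfold psi
  fun_prop

lemma measurable_phi (h0 : 0 < τ) (h1 : τ < 1) (hp1 : 1 < p) : Measurable (phi τ p) :=
  (monotone_phi h0 h1 hp1).measurable

lemma measurable_remainder (h0 : 0 < τ) (h1 : τ < 1) (hp1 : 1 < p) (h : ℝ) :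
    Measurable fun e => remainder τ p e h := by
  have he : Measurable (eta τ p) :=
    (continuous_iff_continuousAt.2 fun s =>
      (hasDerivAt_eta h0 h1 hp1 s).continuousAt).measurable
  have hf := measurable_phi h0 h1 hp1
  unfold remainder
  fun_prop

/-- For `p < 2` the integrand `|s - b| ^ (p - 2)` is infinite at `s = b`, which excludes an atom. -/
lemma measure_singleton_eq_zero (hp2 : p < 2)
    (hfin : ∫⁻ s, ENNReal.ofReal |s - b| ^ (p - 2) ∂ν < ⊤) : ν {b} = 0 := by
  have hm : Measurable fun s : ℝ => ENNReal.ofReal |s - b| ^ (p - 2) := by fun_prop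
  have h := ae_lt_top hm hfin.ne
  rw [measure_eq_zero_iff_ae_notMem]
  filter_upwards [h] with s hs hsb
  rw [Set.mem_singleton_iff] at hsb
  rw [hsb, sub_self, abs_zero, ENNReal.ofReal_zero, ENNReal.zero_rpow_of_neg (by linarith)] at hs
  exact lt_irrefl _ hs

lemma integrable_abs_rpow_sub (hp2 : p ≤ 2) [IsFiniteMeasure ν]
    (hfin : ∫⁻ s, ENNReal.ofReal |s - b| ^ (p - 2) ∂ν < ⊤) :
    Integrable (fun s => |s - b| ^ (p - 2)) ν := by
  rcases hp2.lt_or_eq with hp2 | rfl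
  · have hm : Measurable fun s : ℝ => |s - b| ^ (p - 2) := by fun_prop
    refine ⟨hm.aestronglyMeasurable, ?_⟩
    rw [hasFiniteIntegral_iff_enorm]
    refine lt_of_le_of_lt (lintegral_mono_ae ?_) hfin
    filter_upwards [measure_eq_zero_iff_ae_notMem.1 (measure_singleton_eq_zero hp2 hfin)] with s hs
    have hs : 0 < |s - b| := abs_pos.2 (sub_ne_zero.2 hs)
    rw [ENNReal.ofReal_rpow_of_pos hs, Real.enorm_of_nonneg (by positivity)]
  · simp

variable (h0 : 0 < τ) (h1 : τ < 1) (hp1 : 1 < p) (hp2 : p ≤ 2)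
include h0 h1 hp1

lemma integrable_psi (hint : Integrable (fun s => |s - b| ^ (p - 2)) ν) :
    Integrable (fun s => psi τ p (s - b)) ν := by
  refine (hint.const_mul (p * (p - 1))).mono'
    ((measurable_psi τ p).comp (measurable_id.sub_const b)).aestronglyMeasurable
    (Eventually.of_forall fun s => abs_psi_le h0 h1 hp1 _)

include hp2

lemma memLp_phi [IsFiniteMeasure ν] (hmoment : Integrable (fun s : ℝ => |s| ^ (2 * (p - 1))) ν)
    (b : ℝ) : MemLp (fun s => phi τ p (s - b)) 2 ν := by
  have hg : MemLp (fun s : ℝ => |s| ^ (p - 1)) 2 ν := by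
    have hm : Measurable fun s : ℝ => |s| ^ (p - 1) := by fun_prop
    rw [memLp_two_iff_integrable_sq hm.aestronglyMeasurable]
    refine hmoment.congr (Eventually.of_forall fun s => ?_)
    simp only
    rw [← Real.rpow_mul_natCast (abs_nonneg s)]
    congr 1
    push_cast
    ring
  refine ((hg.const_mul p).add (memLp_const (2 * p * |b| ^ (p - 1)))).mono
    ((measurable_phi h0 h1 hp1).comp (measurable_id.sub_const b)).aestronglyMeasurable
    (Eventually.of_forall fun s => ?_)
  have hb := abs_phi_sub_le h0 h1 hp1 hp2 (s - b) s
  have hs := abs_phi_le h0 h1 hp1 s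
  rw [show s - b - s = -b by ring, abs_neg] at hb
  have h3 := abs_sub_abs_le_abs_sub (phi τ p (s - b)) (phi τ p s)
  refine le_trans ?_ (le_abs_self _)
  rw [Real.norm_eq_abs]
  simp only [Pi.add_apply]
  linarith

lemma integrable_remainder [IsFiniteMeasure ν] (b h : ℝ) :
    Integrable (fun s => remainder τ p (s - b) h) ν := by
  refine (integrable_const (2 * p * |h| ^ p)).mono'
    ((measurable_remainder h0 h1 hp1 h).comp (measurable_id.sub_const b)).aestronglyMeasurable
    (Eventually.of_forall fun s => ?_)
  rw [Real.norm_of_nonneg (remainder_nonneg h0 h1 hp1 _ _)]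
  exact remainder_le h0 h1 hp1 hp2 _ _

/-- First order condition at an `L^p`-quantile: the score has mean zero. -/
lemma integral_phi_eq_zero [IsProbabilityMeasure ν]
    (hmoment : Integrable (fun s : ℝ => |s| ^ (2 * (p - 1))) ν) (hb : IsLpQuantile ν p τ b) :
    ∫ s, phi τ p (s - b) ∂ν = 0 := by
  have hphi : ∀ c, Integrable (fun s => phi τ p (s - c)) ν := fun c =>
    (memLp_phi h0 h1 hp1 hp2 hmoment c).integrable (by norm_num)
  have hincr : ∀ c h, Integrable (fun s => eta τ p (s - c - h) - eta τ p (s - c)) ν := by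
    intro c h
    refine ((integrable_remainder h0 h1 hp1 hp2 c h).sub ((hphi c).mul_const h)).congr
      (Eventually.of_forall fun s => ?_)
    simp only [Pi.sub_apply, remainder]
    ring
  have hloss : ∀ c, Integrable (fun s => eta τ p (s - c) - eta τ p s) ν := fun c => by
    simpa using hincr 0 c
  set μ := ∫ s, phi τ p (s - b) ∂ν with hμ
  have key : ∀ h : ℝ, 0 ≤ 2 * p * |h| ^ p - h * μ := by
    intro h
    have hq := hb (b + h)
    rw [← sub_nonneg, ← integral_sub (hloss _) (hloss _)] at hq
    have e1 : ∀ s, eta τ p (s - (b + h)) - eta τ p s - (eta τ p (s - b) - eta τ p s) =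
        remainder τ p (s - b) h - phi τ p (s - b) * h := fun s => by
      rw [remainder, show s - (b + h) = s - b - h by ring]; ring
    simp_rw [e1] at hq
    rw [integral_sub (integrable_remainder h0 h1 hp1 hp2 b h) ((hphi b).mul_const h),
      integral_mul_const, ← hμ] at hq
    have hle : ∫ s, remainder τ p (s - b) h ∂ν ≤ 2 * p * |h| ^ p := by
      refine (integral_mono (integrable_remainder h0 h1 hp1 hp2 b h) (integrable_const _)
        (fun s => remainder_le h0 h1 hp1 hp2 (s - b) h)).trans_eq ?_
      simp
    linarith
  -- the bound is differentiable at its minimum `h = 0`, with derivative `-μ`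
  have hmin : IsLocalMin (fun h : ℝ => 2 * p * |h| ^ p - h * μ) 0 := by
    refine Eventually.of_forall fun h => ?_
    simpa [Real.zero_rpow (by linarith : p ≠ 0)] using key h
  have hd : HasDerivAt (fun h : ℝ => 2 * p * |h| ^ p - h * μ) (-μ) 0 := by
    refine (((hasDerivAt_abs_rpow 0 hp1).const_mul (2 * p)).sub
      ((hasDerivAt_id (0 : ℝ)).mul_const μ)).congr_deriv ?_
    simp
  linarith [hmin.hasDerivAt_eq_zero hd]

/-- Second order expansion of the expected loss. For `e ≠ 0` this is dominated convergence; an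
atom at the expansion point is harmless only for the symmetric quadratic loss. -/
lemma tendsto_integral_remainder_div_sq [IsProbabilityMeasure ν]
    (hint : Integrable (fun s => |s - b| ^ (p - 2)) ν)
    (hatom : ν {b} = 0 ∨ (p = 2 ∧ τ = 1 / 2)) :
    Tendsto (fun h => (∫ s, remainder τ p (s - b) h ∂ν) / h ^ 2) (𝓝[≠] 0)
      (𝓝 ((∫ s, psi τ p (s - b) ∂ν) / 2)) := by
  rcases hatom with hatom | ⟨rfl, rfl⟩
  · have hne : ∀ᵐ s ∂ν, s - b ≠ 0 := by
      filter_upwards [measure_eq_zero_iff_ae_notMem.1 hatom] with s hs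
      exact sub_ne_zero.2 hs
    simp_rw [← integral_div]
    refine tendsto_integral_filter_of_dominated_convergence (fun s => 8 * p * |s - b| ^ (p - 2))
      (Eventually.of_forall fun h => ?_) ?_ (hint.const_mul _) ?_
    · exact ((integrable_remainder h0 h1 hp1 hp2 b h).div_const _).aestronglyMeasurable
    · filter_upwards [self_mem_nhdsWithin] with h hh
      have hh : h ≠ 0 := hh
      filter_upwards [hne] with s hs
      rw [Real.norm_of_nonneg (div_nonneg (remainder_nonneg h0 h1 hp1 _ _) (sq_nonneg h)),
        div_le_iff₀ (by positivity)]
      exact remainder_le_sq h0 h1 hp1 hp2 hs h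
    · filter_upwards [hne] with s hs
      exact tendsto_remainder_div_sq h0 h1 hp1 hs
  -- for the symmetric quadratic loss the remainder is `h ^ 2 / 2` exactly
  · have hw : ∀ s : ℝ, weight (1 / 2) s = 1 / 2 := fun s => by
      rcases lt_or_ge s 0 with h | h
      · rw [weight_of_neg h1 h]; norm_num
      · rw [weight_of_nonneg h0 h]
    have hpsi : ∀ s : ℝ, psi (1 / 2) 2 s = 1 := fun s => by rw [psi, hw]; norm_num
    have hrem : ∀ s h : ℝ, remainder (1 / 2) 2 s h = h ^ 2 / 2 := fun s h => by
      have hphi : phi (1 / 2) 2 s = s := by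
        rcases le_total 0 s with hs | hs
        · rw [phi_of_nonneg h0 hp1 hs]; norm_num
        · rw [phi_of_nonpos h1 hp1 hs]; norm_num
      simp only [remainder, eta, hw, hphi, Real.rpow_two, sq_abs]
      ring
    simp_rw [hrem, hpsi]
    simp only [integral_const, probReal_univ, smul_eq_mul, one_mul]
    refine tendsto_const_nhds.congr' ?_
    filter_upwards [self_mem_nhdsWithin] with h hh
    have hh : h ≠ 0 := hh
    field_simp

omit hp2 in
lemma integral_psi_pos [IsProbabilityMeasure ν]
    (hint : Integrable (fun s => |s - b| ^ (p - 2)) ν) (hatom : p = 2 ∨ ν {b} = 0) :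
    0 < ∫ s, psi τ p (s - b) ∂ν := by
  have hpp : 0 < p * (p - 1) := mul_pos (by linarith) (by linarith)
  have hpos : ∀ᵐ s ∂ν, 0 < psi τ p (s - b) := by
    rcases hatom with rfl | hatom
    · refine Eventually.of_forall fun s => ?_
      have := weight_pos h0 h1 (s - b)
      simp only [psi, sub_self, Real.rpow_zero]
      positivity
    · filter_upwards [measure_eq_zero_iff_ae_notMem.1 hatom] with s hs
      have hs : 0 < |s - b| := abs_pos.2 (sub_ne_zero.2 hs)
      have := weight_pos h0 h1 (s - b)
      unfold psi
      positivity
  rw [integral_pos_iff_support_of_nonneg_ae (hpos.mono fun s hs => hs.le)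
    (integrable_psi h0 h1 hp1 hint)]
  have : ν (Function.support fun s => psi τ p (s - b)) = 1 := by
    rw [← measure_univ (μ := ν)]
    refine measure_congr ?_
    filter_upwards [hpos] with s hs
    exact eq_iff_iff.2 ⟨fun _ => trivial, fun _ => hs.ne'⟩
  rw [this]
  exact one_pos

end Moments

/-! ### Convex functions close to a quadratic -/

/-- Pointwise closeness of nonnegative convex functions to a continuous function on a suitable
finite set gives uniform closeness on a ball: the values at the vertices of a polytope bound the
convex function, hence its Lipschitz constant, on the ball, and a finite net does the rest. -/
lemma exists_finset_abs_sub_le_of_convexOn {E : Type*} [NormedAddCommGroup E] [NormedSpace ℝ E]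
    [FiniteDimensional ℝ E] {Q : E → ℝ} (hQ : Continuous Q) (r : ℝ) {ε : ℝ} (hε : 0 < ε) :
    ∃ (F : Finset E) (η : ℝ), 0 < η ∧ ∀ A : E → ℝ, ConvexOn ℝ Set.univ A → (∀ θ, 0 ≤ A θ) →
      (∀ θ ∈ F, |A θ - Q θ| ≤ η) → ∀ θ ∈ Metric.closedBall (0 : E) r, |A θ - Q θ| ≤ ε := by
  classical
  obtain ⟨F₁, hF₁, -⟩ := Convex.exists_subset_interior_convexHull_finset_of_isCompact
    (convex_closedBall (0 : E) (r + 2)) (isCompact_closedBall _ _) Filter.univ_mem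
  obtain ⟨M₀, hM₀⟩ := (F₁.finite_toSet.image Q).bddAbove
  set M := max M₀ 0 + 1 with hM
  have hMpos : 0 < M := by positivity
  have hMQ : ∀ θ ∈ F₁, Q θ + 1 ≤ M := fun θ hθ => by
    have := hM₀ (Set.mem_image_of_mem Q hθ)
    have := le_max_left M₀ 0
    linarith
  have hcomp := isCompact_closedBall (0 : E) r
  obtain ⟨δ₁, hδ₁, hQδ⟩ := Metric.uniformContinuousOn_iff.1
    (hcomp.uniformContinuousOn_of_continuous hQ.continuousOn) (ε / 3) (by positivity)
  set δ := min (min δ₁ (ε / (3 * (2 * M)))) 1 with hδ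
  have hδpos : 0 < δ := by positivity
  obtain ⟨F₂, hF₂s, hF₂f, hF₂⟩ := hcomp.finite_cover_balls hδpos
  refine ⟨F₁ ∪ hF₂f.toFinset, min 1 (ε / 3), by positivity, fun A hA hA0 hAF θ hθ => ?_⟩
  have hub : ∀ x, dist x 0 < r + 2 → |A x| ≤ M := by
    intro x hx
    rw [abs_of_nonneg (hA0 x)]
    have hx2 : x ∈ convexHull ℝ (F₁ : Set E) :=
      interior_subset (hF₁ (Metric.mem_closedBall.2 hx.le))
    have hsub : (F₁ : Set E) ⊆ {y ∈ Set.univ | A y ≤ M} := fun y hy => by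
      refine ⟨trivial, ?_⟩
      have h1 := hAF y (Finset.mem_union_left _ hy)
      have h2 := le_abs_self (A y - Q y)
      have h3 := hMQ y hy
      have h4 := min_le_left 1 (ε / 3)
      linarith
    exact (convexHull_min hsub (hA.convex_le M) hx2).2
  have hlip := (hA.subset (Set.subset_univ _)
    (convex_ball (0 : E) (r + 2))).lipschitzOnWith_of_abs_le one_pos hub
  obtain ⟨z, hz, hθz⟩ := Set.mem_iUnion₂.1 (hF₂ hθ)
  have hball : ∀ x ∈ Metric.closedBall (0 : E) r, x ∈ Metric.ball (0 : E) (r + 2 - 1) := fun x hx =>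
    Metric.closedBall_subset_ball (by linarith) hx
  have hd : dist θ z < δ := hθz
  have h1 := hlip.dist_le_mul θ (hball θ hθ) z (hball z (hF₂s hz))
  rw [div_one, Real.coe_toNNReal _ (by positivity), Real.dist_eq] at h1
  have h2 : 2 * M * dist θ z ≤ ε / 3 := by
    have : dist θ z ≤ ε / (3 * (2 * M)) :=
      hd.le.trans ((min_le_left _ _).trans (min_le_right _ _))
    calc 2 * M * dist θ z ≤ 2 * M * (ε / (3 * (2 * M))) := by gcongr
      _ = ε / 3 := by field_simp
  have h3 := hQδ θ hθ z (hF₂s hz) (hd.trans_le ((min_le_left _ _).trans (min_le_left _ _)))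
  rw [Real.dist_eq] at h3
  have h4 := (hAF z (Finset.mem_union_right _ (hF₂f.mem_toFinset.2 hz))).trans (min_le_right _ _)
  calc |A θ - Q θ| = |(A θ - A z) + (A z - Q z) + (Q z - Q θ)| := by ring_nf
    _ ≤ |A θ - A z| + |A z - Q z| + |Q z - Q θ| := abs_add_three _ _ _
    _ ≤ ε := by rw [abs_sub_comm (Q z)]; linarith

/-- If a convex function `Z` is within `ε` of `q` on the closed ball of radius `δ` around `θ₀`, and
`q` exceeds `q θ₀` by more than `2 ε` on the bounding sphere, then `Z` has its minimizers in that
ball. -/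
lemma norm_sub_le_of_convexOn_of_isMinOn {E : Type*} [NormedAddCommGroup E] [NormedSpace ℝ E]
    {Z q : E → ℝ} (hZ : ConvexOn ℝ Set.univ Z) {θ₀ θ : E} {δ ε : ℝ} (hδ : 0 < δ)
    (hclose : ∀ x, ‖x - θ₀‖ ≤ δ → |Z x - q x| ≤ ε)
    (hq : ∀ x, ‖x - θ₀‖ = δ → q θ₀ + 2 * ε < q x) (hmin : ∀ x, Z θ ≤ Z x) :
    ‖θ - θ₀‖ ≤ δ := by
  by_contra! hlt
  set N := ‖θ - θ₀‖ with hN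
  have hNpos : 0 < N := hδ.trans hlt
  set s := δ / N with hs
  have hs0 : 0 ≤ s := by positivity
  have hs1 : s ≤ 1 := (div_le_one hNpos).2 hlt.le
  set x := (1 - s) • θ₀ + s • θ with hx
  have hxn : ‖x - θ₀‖ = δ := by
    have : x - θ₀ = s • (θ - θ₀) := by rw [hx]; module
    rw [this, norm_smul, Real.norm_of_nonneg hs0, ← hN, hs]
    field_simp
  have hconv := hZ.2 (Set.mem_univ θ₀) (Set.mem_univ θ) (by linarith : 0 ≤ 1 - s) hs0 (by ring)
  rw [← hx] at hconv
  simp only [smul_eq_mul] at hconv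
  have h1 : Z x ≤ Z θ₀ := by nlinarith [mul_le_mul_of_nonneg_left (hmin θ₀) hs0]
  have h2 := abs_le.1 (hclose x hxn.le)
  have h3 := abs_le.1 (hclose θ₀ (by simpa using hδ.le))
  have h4 := hq x hxn
  linarith

/-! ### Sums over asymptotically negligible arrays -/

section Arrays

variable {c : ℕ → ℝ} {L : ℝ}

/-- Convergence of the averages of `c t ^ 2` forces `max_{t < T} |c t| / √T → 0`. -/
lemma eventually_abs_div_sqrt_le
    (hc : Tendsto (fun T : ℕ => (T : ℝ)⁻¹ * ∑ t ∈ Finset.range T, c t ^ 2) atTop (𝓝 L))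
    {ε : ℝ} (hε : 0 < ε) : ∀ᶠ T : ℕ in atTop, ∀ t < T, |c t / √(T : ℝ)| ≤ ε := by
  -- `c T ^ 2 / T` is the difference of two consecutive averages, up to a factor tending to one
  have hlast : Tendsto (fun T : ℕ => (T : ℝ)⁻¹ * c T ^ 2) atTop (𝓝 0) := by
    have hr : Tendsto (fun T : ℕ => ((T : ℝ) + 1) / T) atTop (𝓝 1) := by
      have := (tendsto_const_nhds (x := (1 : ℝ))).add tendsto_inv_atTop_nhds_zero_nat
      rw [add_zero] at this
      refine this.congr' ?_
      filter_upwards [eventually_gt_atTop 0] with T hT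
      have : (T : ℝ) ≠ 0 := by positivity
      field_simp
    have h := (((tendsto_add_atTop_iff_nat 1).2 hc).mul hr).sub hc
    rw [mul_one, sub_self] at h
    refine h.congr' ?_
    filter_upwards [eventually_gt_atTop 0] with T hT
    have : (T : ℝ) ≠ 0 := by positivity
    rw [Finset.sum_range_succ]
    push_cast
    field_simp
    ring
  obtain ⟨N, hN⟩ := eventually_atTop.1 (hlast.eventually_le_const (by positivity : 0 < ε ^ 2))
  have hfirst : ∀ᶠ T : ℕ in atTop, ∑ t ∈ Finset.range (N + 1), c t ^ 2 ≤ ε ^ 2 * T := by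
    have h := (tendsto_natCast_atTop_atTop (R := ℝ)).const_mul_atTop (by positivity : 0 < ε ^ 2)
    exact h.eventually_ge_atTop _
  filter_upwards [hfirst, eventually_gt_atTop 0] with T hT hT0 t ht
  have hTpos : (0 : ℝ) < T := by exact_mod_cast hT0
  refine abs_le_of_sq_le_sq ?_ hε.le
  rw [div_pow, Real.sq_sqrt hTpos.le, div_le_iff₀ hTpos]
  rcases le_or_gt t N with h | h
  · exact (Finset.single_le_sum (f := fun t => c t ^ 2) (fun i _ => sq_nonneg _)
      (Finset.mem_range.2 (by omega))).trans hT
  · have h2 := hN t h.le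
    have ht0 : (0 : ℝ) < t := by exact_mod_cast (by omega : 0 < t)
    rw [inv_mul_le_iff₀ ht0] at h2
    have : (t : ℝ) ≤ T := by exact_mod_cast ht.le
    nlinarith [sq_nonneg ε]

lemma sum_div_sqrt_sq (c : ℕ → ℝ) (T : ℕ) :
    ∑ t ∈ Finset.range T, (c t / √(T : ℝ)) ^ 2 = (T : ℝ)⁻¹ * ∑ t ∈ Finset.range T, c t ^ 2 := by
  rw [Finset.mul_sum]
  refine Finset.sum_congr rfl fun t _ => ?_
  rw [div_pow, Real.sq_sqrt (Nat.cast_nonneg T)]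
  ring

lemma tendsto_sum_norm_of_isLittleO_sq {E : Type*} [NormedAddCommGroup E]
    (hc : Tendsto (fun T : ℕ => (T : ℝ)⁻¹ * ∑ t ∈ Finset.range T, c t ^ 2) atTop (𝓝 L))
    {f : ℝ → E} (hf : f =o[𝓝 0] fun h => h ^ 2) :
    Tendsto (fun T : ℕ => ∑ t ∈ Finset.range T, ‖f (c t / √(T : ℝ))‖) atTop (𝓝 0) := by
  have hL : 0 ≤ L := ge_of_tendsto' hc fun T =>
    mul_nonneg (by positivity) (Finset.sum_nonneg fun _ _ => sq_nonneg _)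
  rw [Metric.tendsto_nhds]
  intro ε hε
  have hε' : 0 < ε / (2 * (L + 1)) := by positivity
  obtain ⟨δ, hδ, hδf⟩ := Metric.eventually_nhds_iff.1 (hf.def hε')
  filter_upwards [eventually_abs_div_sqrt_le hc (half_pos hδ),
    hc.eventually_le_const (lt_add_one L)] with T hT hTL
  rw [Real.dist_0_eq_abs, abs_of_nonneg (Finset.sum_nonneg fun _ _ => norm_nonneg _)]
  calc ∑ t ∈ Finset.range T, ‖f (c t / √(T : ℝ))‖
      ≤ ∑ t ∈ Finset.range T, ε / (2 * (L + 1)) * (c t / √(T : ℝ)) ^ 2 := by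
        refine Finset.sum_le_sum fun t ht => ?_
        have := hT t (Finset.mem_range.1 ht)
        have h := hδf (y := c t / √(T : ℝ)) (by rw [Real.dist_0_eq_abs]; linarith)
        rwa [Real.norm_of_nonneg (sq_nonneg _)] at h
    _ = ε / (2 * (L + 1)) * ((T : ℝ)⁻¹ * ∑ t ∈ Finset.range T, c t ^ 2) := by
        rw [← Finset.mul_sum, sum_div_sqrt_sq]
    _ ≤ ε / (2 * (L + 1)) * (L + 1) := by gcongr
    _ = ε / 2 := by field_simp
    _ < ε := half_lt_self hε

/-- If `f h ∼ κ h ^ 2` at the origin, then the sums of `f (c t / √T)` converge to `κ L`. -/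
lemma tendsto_sum_of_tendsto_div_sq
    (hc : Tendsto (fun T : ℕ => (T : ℝ)⁻¹ * ∑ t ∈ Finset.range T, c t ^ 2) atTop (𝓝 L))
    {f : ℝ → ℝ} {κ : ℝ} (hf0 : f 0 = 0)
    (hf : Tendsto (fun h => f h / h ^ 2) (𝓝[≠] 0) (𝓝 κ)) :
    Tendsto (fun T : ℕ => ∑ t ∈ Finset.range T, f (c t / √(T : ℝ))) atTop (𝓝 (κ * L)) := by
  have ho : (fun h => f h - κ * h ^ 2) =o[𝓝 0] fun h : ℝ => h ^ 2 := by
    rw [Asymptotics.isLittleO_iff]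
    intro ε hε
    have h := Metric.tendsto_nhds.1 hf ε hε
    rw [eventually_nhdsWithin_iff] at h
    filter_upwards [h] with x hx
    rcases eq_or_ne x 0 with rfl | hx0
    · simp [hf0]
    · have h2 := hx hx0
      rw [Real.dist_eq] at h2
      have e : f x - κ * x ^ 2 = (f x / x ^ 2 - κ) * x ^ 2 := by field_simp
      rw [e, norm_mul, Real.norm_eq_abs]
      exact mul_le_mul_of_nonneg_right h2.le (norm_nonneg _)
  have h0 := tendsto_sum_norm_of_isLittleO_sq hc ho
  have h1 : Tendsto (fun T : ℕ => ∑ t ∈ Finset.range T,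
      (f (c t / √(T : ℝ)) - κ * (c t / √(T : ℝ)) ^ 2)) atTop (𝓝 0) := by
    refine squeeze_zero_norm (fun T => ?_) h0
    exact norm_sum_le _ _
  have h2 := h1.add (hc.const_mul κ)
  rw [zero_add] at h2
  refine h2.congr fun T => ?_
  rw [Finset.sum_sub_distrib, ← Finset.mul_sum, sum_div_sqrt_sq]
  ring

end Arrays

/-! ### Second moments of the design -/

section Design

variable {m : ℕ} {x : ℕ → EuclideanSpace ℝ (Fin m)} {C : Matrix (Fin m) (Fin m) ℝ}

lemma sum_inner_sq_eq (x : ℕ → EuclideanSpace ℝ (Fin m)) (v : EuclideanSpace ℝ (Fin m)) (T : ℕ) :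
    ∑ t ∈ Finset.range T, inner ℝ (x t) v ^ 2 =
      v.ofLp ⬝ᵥ (((designMatrix x T).transpose * designMatrix x T).mulVec v.ofLp) := by
  rw [← Matrix.mulVec_mulVec, Matrix.dotProduct_mulVec, Matrix.vecMul_transpose, dotProduct,
    ← Fin.sum_univ_eq_sum_range (fun t => inner ℝ (x t) v ^ 2)]
  refine Finset.sum_congr rfl fun t _ => ?_
  have : inner ℝ (x t) v = (designMatrix x T).mulVec v.ofLp t := by
    simp only [PiLp.inner_apply, Matrix.mulVec, dotProduct, designMatrix, Matrix.of_apply]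
    refine Finset.sum_congr rfl fun i _ => ?_
    simp [mul_comm]
  rw [this]
  ring

/-- The cross term between intercept and slope vanishes because the predictors are centered. -/
lemma tendsto_average_sq
    (hx : Tendsto (fun T : ℕ => (T : ℝ)⁻¹ • ∑ t ∈ Finset.range T, x t) atTop (𝓝 0))
    (hXC : Tendsto (fun T : ℕ => (T : ℝ)⁻¹ •
      ((designMatrix x T).transpose * designMatrix x T)) atTop (𝓝 C))
    (u : ℝ) (v : EuclideanSpace ℝ (Fin m)) :
    Tendsto (fun T : ℕ => (T : ℝ)⁻¹ * ∑ t ∈ Finset.range T, (u + inner ℝ (x t) v) ^ 2) atTop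
      (𝓝 (u ^ 2 + v.ofLp ⬝ᵥ C.mulVec v.ofLp)) := by
  have h1 : Tendsto (fun T : ℕ => (T : ℝ)⁻¹ * ∑ t ∈ Finset.range T, inner ℝ (x t) v ^ 2) atTop
      (𝓝 (v.ofLp ⬝ᵥ C.mulVec v.ofLp)) := by
    have hcont : Continuous fun M : Matrix (Fin m) (Fin m) ℝ => v.ofLp ⬝ᵥ M.mulVec v.ofLp := by
      fun_prop
    refine ((hcont.tendsto C).comp hXC).congr fun T => ?_
    simp only [Function.comp_apply]
    rw [sum_inner_sq_eq, Matrix.smul_mulVec, dotProduct_smul, smul_eq_mul]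
  have h2 : Tendsto (fun T : ℕ => inner ℝ ((T : ℝ)⁻¹ • ∑ t ∈ Finset.range T, x t) v) atTop
      (𝓝 0) := by
    have := hx.inner (tendsto_const_nhds (x := v) (f := atTop)) (𝕜 := ℝ)
    rwa [inner_zero_left] at this
  have h3 := ((h2.const_mul (2 * u)).const_add (u ^ 2)).add h1
  rw [mul_zero, add_zero] at h3
  refine h3.congr' ?_
  filter_upwards [eventually_gt_atTop 0] with T hT
  have hT : (T : ℝ) ≠ 0 := by positivity
  have e : ∀ t, (u + inner ℝ (x t) v) ^ 2 =
      u ^ 2 + 2 * u * inner ℝ (x t) v + inner ℝ (x t) v ^ 2 := fun t => by ring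
  simp_rw [e]
  rw [Finset.sum_add_distrib, Finset.sum_add_distrib, ← Finset.mul_sum, Finset.sum_const,
    Finset.card_range, nsmul_eq_mul, inner_smul_left, sum_inner]
  simp only [RCLike.conj_to_real]
  field_simp

end Design

/-! ### Sums of functions of i.i.d. errors -/

section IID

variable {Ω : Type*} [MeasurableSpace Ω] {P : Measure Ω} [IsProbabilityMeasure P]
  {ν : Measure ℝ} [IsProbabilityMeasure ν] {ε : ℕ → Ω → ℝ}

omit [IsProbabilityMeasure P] [IsProbabilityMeasure ν] in
lemma memLp_comp_of_hasLaw {X : Ω → ℝ} (hX : HasLaw X ν P) {g : ℝ → ℝ} (hg : MemLp g 2 ν) :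
    MemLp (fun ω => g (X ω)) 2 P := by
  rw [← hX.map_eq] at hg
  exact (memLp_map_measure_iff hg.1 hX.aemeasurable).1 hg

omit [IsProbabilityMeasure ν] in
/-- Chebyshev's inequality for a sum of functions of the errors. -/
lemma measureReal_le_abs_sum_sub_le (hlaw : ∀ t, HasLaw (ε t) ν P) (hindep : iIndepFun ε P)
    {g : ℕ → ℝ → ℝ} (hgm : ∀ t, Measurable (g t)) (hg : ∀ t, MemLp (g t) 2 ν) (T : ℕ) {M : ℝ}
    (hM : 0 < M) :
    P.real {ω | M ≤ |∑ t ∈ Finset.range T, g t (ε t ω) - ∑ t ∈ Finset.range T, ∫ s, g t s ∂ν|} ≤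
      (∑ t ∈ Finset.range T, ∫ s, g t s ^ 2 ∂ν) / M ^ 2 := by
  set X : ℕ → Ω → ℝ := fun t ω => g t (ε t ω) with hX
  have hXL : ∀ t, MemLp (X t) 2 P := fun t => memLp_comp_of_hasLaw (hlaw t) (hg t)
  have hXi : iIndepFun X P := hindep.comp g hgm
  have hmean : P[∑ t ∈ Finset.range T, X t] = ∑ t ∈ Finset.range T, ∫ s, g t s ∂ν := by
    simp only [Finset.sum_apply]
    rw [integral_finsetSum _ fun t _ => (hXL t).integrable (by norm_num)]
    exact Finset.sum_congr rfl fun t _ => (hlaw t).integral_comp (hg t).1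
  have hvar : variance (∑ t ∈ Finset.range T, X t) P ≤
      ∑ t ∈ Finset.range T, ∫ s, g t s ^ 2 ∂ν := by
    rw [IndepFun.variance_sum (fun t _ => hXL t) fun i _ j _ hij => hXi.indepFun hij]
    refine Finset.sum_le_sum fun t _ => ?_
    refine (variance_le_expectation_sq (hXL t).1).trans_eq ?_
    exact (hlaw t).integral_comp (f := fun s => g t s ^ 2) ((hg t).1.pow 2)
  have hcheb := meas_ge_le_variance_div_sq
    (memLp_finsetSum' (Finset.range T) fun t _ => hXL t) hM
  rw [hmean] at hcheb
  simp only [Finset.sum_apply] at hcheb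
  rw [measureReal_def]
  refine (ENNReal.toReal_mono ENNReal.ofReal_ne_top hcheb).trans ?_
  rw [ENNReal.toReal_ofReal (div_nonneg (variance_nonneg _ _) (sq_nonneg _))]
  gcongr

omit [IsProbabilityMeasure ν] in
/-- Normalized weighted sums of centered square integrable functions of the errors are bounded in
probability. -/
lemma exists_forall_measureReal_le (hlaw : ∀ t, HasLaw (ε t) ν P) (hindep : iIndepFun ε P)
    {Z : ℝ → ℝ} (hZm : Measurable Z) (hZ : MemLp Z 2 ν) (hZ0 : ∫ s, Z s ∂ν = 0)
    {c : ℕ → ℝ} {L : ℝ}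
    (hc : Tendsto (fun T : ℕ => (T : ℝ)⁻¹ * ∑ t ∈ Finset.range T, c t ^ 2) atTop (𝓝 L))
    {α : ℝ} (hα : 0 < α) :
    ∃ M : ℝ, ∀ᶠ T : ℕ in atTop,
      P.real {ω | M ≤ |∑ t ∈ Finset.range T, c t / √(T : ℝ) * Z (ε t ω)|} ≤ α := by
  have hL : 0 ≤ L := ge_of_tendsto' hc fun T =>
    mul_nonneg (by positivity) (Finset.sum_nonneg fun _ _ => sq_nonneg _)
  set σ := ∫ s, Z s ^ 2 ∂ν with hσ
  have hσ0 : 0 ≤ σ := integral_nonneg fun s => sq_nonneg _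
  -- the threshold makes Chebyshev's bound `σ (L + 1) / M ^ 2` at most `α`; the summand `1` keeps
  -- it positive when `σ = 0`
  refine ⟨√((σ * (L + 1) + 1) / α), ?_⟩
  filter_upwards [hc.eventually_le_const (lt_add_one L)] with T hT
  have h := measureReal_le_abs_sum_sub_le hlaw hindep
    (g := fun t s => c t / √(T : ℝ) * Z s) (fun t => hZm.const_mul _) (fun t => hZ.const_mul _) T
    (by positivity : 0 < √((σ * (L + 1) + 1) / α))
  simp only [integral_const_mul, hZ0, mul_zero, Finset.sum_const_zero, sub_zero, mul_pow,
    ← hσ] at h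
  rw [← Finset.sum_mul, sum_div_sqrt_sq, Real.sq_sqrt (by positivity)] at h
  refine h.trans ?_
  rw [div_le_iff₀ (by positivity), mul_div_cancel₀ _ hα.ne']
  nlinarith [mul_le_mul_of_nonneg_right hT hσ0]

lemma norm_prod_sub_prod_le (z w : ℕ → ℂ) (hz : ∀ t, ‖z t‖ ≤ 1) (hw : ∀ t, ‖w t‖ ≤ 1) (T : ℕ) :
    ‖∏ t ∈ Finset.range T, z t - ∏ t ∈ Finset.range T, w t‖ ≤
      ∑ t ∈ Finset.range T, ‖z t - w t‖ := by
  induction T with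
  | zero => simp
  | succ n ih =>
    rw [Finset.prod_range_succ, Finset.prod_range_succ, Finset.sum_range_succ]
    have hprod : ‖∏ t ∈ Finset.range n, w t‖ ≤ 1 := by
      rw [norm_prod]
      exact Finset.prod_le_one (fun _ _ => norm_nonneg _) fun t _ => hw t
    calc ‖(∏ t ∈ Finset.range n, z t) * z n - (∏ t ∈ Finset.range n, w t) * w n‖
        = ‖(∏ t ∈ Finset.range n, z t - ∏ t ∈ Finset.range n, w t) * z n +
            (∏ t ∈ Finset.range n, w t) * (z n - w n)‖ := by ring_nf
      _ ≤ ‖∏ t ∈ Finset.range n, z t - ∏ t ∈ Finset.range n, w t‖ * ‖z n‖ +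
            ‖∏ t ∈ Finset.range n, w t‖ * ‖z n - w n‖ := by
          refine (norm_add_le _ _).trans ?_
          rw [norm_mul, norm_mul]
      _ ≤ ‖∏ t ∈ Finset.range n, z t - ∏ t ∈ Finset.range n, w t‖ * 1 + 1 * ‖z n - w n‖ := by
          gcongr
          exact hz n
      _ ≤ _ := by linarith

lemma charFun_sub_exp_isLittleO {Z : ℝ → ℝ} (hZm : Measurable Z) (hZ : MemLp Z 2 ν)
    (hZ0 : ∫ s, Z s ∂ν = 0) :
    (fun a : ℝ => charFun (ν.map Z) a - Complex.exp (-((∫ s, Z s ^ 2 ∂ν : ℝ) * a ^ 2 / 2)))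
      =o[𝓝 0] fun a => a ^ 2 := by
  have : IsProbabilityMeasure (ν.map Z) := Measure.isProbabilityMeasure_map hZm.aemeasurable
  have hmem : MemLp id 2 (ν.map Z) := (memLp_map_measure_iff (by fun_prop) hZm.aemeasurable).2 hZ
  set σ := ∫ s, Z s ^ 2 ∂ν with hσ
  have h1 : (fun a : ℝ => charFun (ν.map Z) a - (1 - σ * a ^ 2 / 2)) =o[𝓝 0] fun a => a ^ 2 := by
    have h := taylor_isLittleO_univ (x₀ := 0) (contDiff_charFun (n := 2) hmem)
    simp only [sub_zero] at h
    refine h.congr_left fun a => ?_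
    rw [taylorWithinEval_charFun_two_zero hZm.aemeasurable hmem, hZ0]
    simp [hσ]
  have h2 : (fun a : ℝ => Complex.exp (-(σ * a ^ 2 / 2)) - (1 - σ * a ^ 2 / 2))
      =o[𝓝 0] fun a => a ^ 2 := by
    have he := (hasDerivAt_iff_isLittleO_nhds_zero.1 (Complex.hasDerivAt_exp 0))
    have ht : Tendsto (fun a : ℝ => (-(σ * a ^ 2 / 2) : ℂ)) (𝓝 0) (𝓝 0) := by
      have : Continuous fun a : ℝ => (-(σ * a ^ 2 / 2) : ℂ) := by fun_prop
      simpa using this.tendsto 0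
    have h3 := he.comp_tendsto ht
    have h4 : ((fun z : ℂ => z) ∘ fun a : ℝ => (-(σ * a ^ 2 / 2) : ℂ)) =O[𝓝 0]
        fun a : ℝ => a ^ 2 := by
      refine Asymptotics.IsBigO.of_bound (|σ| / 2) (Eventually.of_forall fun a => ?_)
      simp [norm_pow]
      exact le_of_eq (by ring)
    refine (h3.trans_isBigO h4).congr_left fun a => ?_
    simp
    ring
  refine (h1.sub h2).congr_left fun a => ?_
  ring

omit [IsProbabilityMeasure P] in
/-- Lindeberg's central limit theorem for normalized weighted sums with vector weights, on the
level of characteristic functions. -/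
lemma tendsto_charFun_weighted_sum {E : Type*} [NormedAddCommGroup E] [InnerProductSpace ℝ E]
    [MeasurableSpace E] [BorelSpace E] [SecondCountableTopology E]
    (hlaw : ∀ t, HasLaw (ε t) ν P) (hindep : iIndepFun ε P)
    {Z : ℝ → ℝ} (hZm : Measurable Z) (hZ : MemLp Z 2 ν) (hZ0 : ∫ s, Z s ∂ν = 0)
    (w : ℕ → E) (ξ : E) {L : ℝ}
    (hc : Tendsto (fun T : ℕ => (T : ℝ)⁻¹ * ∑ t ∈ Finset.range T, inner ℝ (w t) ξ ^ 2) atTop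
      (𝓝 L)) :
    Tendsto (fun T : ℕ => charFun
      (P.map fun ω => ∑ t ∈ Finset.range T, Z (ε t ω) • (√(T : ℝ))⁻¹ • w t) ξ) atTop
      (𝓝 (Complex.exp (-((∫ s, Z s ^ 2 ∂ν : ℝ) * L / 2 : ℝ)))) := by
  have : IsProbabilityMeasure (ν.map Z) := Measure.isProbabilityMeasure_map hZm.aemeasurable
  set σ := ∫ s, Z s ^ 2 ∂ν with hσ
  have hσ0 : 0 ≤ σ := integral_nonneg fun s => sq_nonneg _
  have hprod : ∀ T : ℕ, charFun
      (P.map fun ω => ∑ t ∈ Finset.range T, Z (ε t ω) • (√(T : ℝ))⁻¹ • w t) ξ =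
      ∏ t ∈ Finset.range T, charFun (ν.map Z) (inner ℝ (w t) ξ / √(T : ℝ)) := by
    intro T
    have hX : iIndepFun (fun t ω => Z (ε t ω) • (√(T : ℝ))⁻¹ • w t) P :=
      hindep.comp (fun t s => Z s • (√(T : ℝ))⁻¹ • w t) fun t => hZm.smul_const _
    have hm : ∀ t, AEMeasurable (fun ω => Z (ε t ω) • (√(T : ℝ))⁻¹ • w t) P := fun t =>
      (hZm.comp_aemeasurable (hlaw t).aemeasurable).smul_const _
    rw [(hX.restrict _).charFun_map_fun_finsetSum_eq_prod fun t _ => hm t, Finset.prod_apply]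
    refine Finset.prod_congr rfl fun t _ => ?_
    have hmap : P.map (fun ω => Z (ε t ω)) = ν.map Z := by
      rw [← (hlaw t).map_eq, AEMeasurable.map_map_of_aemeasurable hZm.aemeasurable
        (hlaw t).aemeasurable]
      rfl
    have hmz : AEMeasurable (fun ω => Z (ε t ω)) P :=
      hZm.comp_aemeasurable (hlaw t).aemeasurable
    rw [← hmap, charFun_apply, charFun_apply_real, integral_map (hm t) (by fun_prop),
      integral_map hmz (by fun_prop)]
    refine integral_congr_ae (Eventually.of_forall fun ω => ?_)
    simp only [inner_smul_left, RCLike.conj_to_real]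
    congr 1
    push_cast
    ring
  have hexp : ∀ T : ℕ, ∏ t ∈ Finset.range T,
      Complex.exp (-(σ * ((inner ℝ (w t) ξ / √(T : ℝ) : ℝ) : ℂ) ^ 2 / 2)) =
      Complex.exp (-(σ * ((T : ℝ)⁻¹ * ∑ t ∈ Finset.range T, inner ℝ (w t) ξ ^ 2) / 2 : ℝ)) := by
    intro T
    rw [← Complex.exp_sum, ← sum_div_sqrt_sq]
    congr 1
    push_cast
    rw [Finset.mul_sum, Finset.sum_div, Finset.sum_neg_distrib]
  have hlim : Tendsto (fun T : ℕ =>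
      Complex.exp (-(σ * ((T : ℝ)⁻¹ * ∑ t ∈ Finset.range T, inner ℝ (w t) ξ ^ 2) / 2 : ℝ))) atTop
      (𝓝 (Complex.exp (-(σ * L / 2 : ℝ)))) := by
    have hcont : Continuous fun a : ℝ => Complex.exp (-(σ * a / 2 : ℝ)) := by fun_prop
    exact (hcont.tendsto L).comp hc
  have hdiff := tendsto_sum_norm_of_isLittleO_sq hc (charFun_sub_exp_isLittleO hZm hZ hZ0)
  have hd : Tendsto (fun T : ℕ =>
      ∏ t ∈ Finset.range T, charFun (ν.map Z) (inner ℝ (w t) ξ / √(T : ℝ)) -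
      ∏ t ∈ Finset.range T,
        Complex.exp (-(σ * ((inner ℝ (w t) ξ / √(T : ℝ) : ℝ) : ℂ) ^ 2 / 2))) atTop (𝓝 0) := by
    refine squeeze_zero_norm (fun T => ?_) hdiff
    refine norm_prod_sub_prod_le _ _ (fun t => norm_charFun_le_one _) (fun t => ?_) T
    rw [Complex.norm_exp, Real.exp_le_one_iff]
    norm_cast
    rw [neg_nonpos]
    positivity
  have := hd.add hlim
  rw [zero_add] at this
  refine this.congr fun T => ?_
  rw [hprod, hexp]
  ring

end IID

/-! ### The localized objective -/

section Local

variable {m K : ℕ}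

/-- The linear predictor `u_k + xₜ'v` at the local parameter `θ = (u, v)`. -/
noncomputable def localShift (x : ℕ → EuclideanSpace ℝ (Fin m)) (t : ℕ) (k : Fin K) :
    ((Fin K → ℝ) × EuclideanSpace ℝ (Fin m)) →ₗ[ℝ] ℝ :=
  (LinearMap.proj (R := ℝ) (φ := fun _ : Fin K => ℝ) k).comp (LinearMap.fst ℝ _ _) +
    (innerₗ (EuclideanSpace ℝ (Fin m)) (x t)).comp (LinearMap.snd ℝ _ _)

lemma localShift_apply (x : ℕ → EuclideanSpace ℝ (Fin m)) (t : ℕ) (k : Fin K)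
    (θ : (Fin K → ℝ) × EuclideanSpace ℝ (Fin m)) :
    localShift x t k θ = θ.1 k + inner ℝ (x t) θ.2 := rfl

/-- The part of the localized objective beyond first order, as a function of the local parameter
`θ = √T ((b, β) - (b*, β*))`, for the error sequence `e`. -/
noncomputable def remainderSum (p : ℝ) (τ b : Fin K → ℝ) (x : ℕ → EuclideanSpace ℝ (Fin m))
    (e : ℕ → ℝ) (T : ℕ) (θ : (Fin K → ℝ) × EuclideanSpace ℝ (Fin m)) : ℝ :=
  ∑ k, ∑ t ∈ Finset.range T, remainder (τ k) p (e t - b k) (localShift x t k θ / √(T : ℝ))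

/-- The first order part of the localized objective, with its sign reversed. -/
noncomputable def scoreSum (p : ℝ) (τ b : Fin K → ℝ) (x : ℕ → EuclideanSpace ℝ (Fin m))
    (e : ℕ → ℝ) (T : ℕ) (θ : (Fin K → ℝ) × EuclideanSpace ℝ (Fin m)) : ℝ :=
  ∑ k, ∑ t ∈ Finset.range T, phi (τ k) p (e t - b k) * (localShift x t k θ / √(T : ℝ))

/-- The quadratic limit `½ ∑ₖ κₖ (uₖ² + v'Cv)` of `remainderSum`. -/
noncomputable def quadLimit (κ : Fin K → ℝ) (C : Matrix (Fin m) (Fin m) ℝ)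
    (θ : (Fin K → ℝ) × EuclideanSpace ℝ (Fin m)) : ℝ :=
  ∑ k, κ k / 2 * (θ.1 k ^ 2 + θ.2.ofLp ⬝ᵥ C.mulVec θ.2.ofLp)

/-- The vector `(∑ₖ κₖ)⁻¹ C⁻¹ w`. -/
noncomputable def precondition (κ : Fin K → ℝ) (C : Matrix (Fin m) (Fin m) ℝ)
    (w : EuclideanSpace ℝ (Fin m)) : EuclideanSpace ℝ (Fin m) :=
  WithLp.toLp 2 ((∑ k, κ k)⁻¹ • C⁻¹.mulVec w.ofLp)

/-- The slope part of `center`. -/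
noncomputable def slopeCenter (κ : Fin K → ℝ) (C : Matrix (Fin m) (Fin m) ℝ) (p : ℝ)
    (τ b : Fin K → ℝ) (x : ℕ → EuclideanSpace ℝ (Fin m)) (e : ℕ → ℝ) (T : ℕ) :
    EuclideanSpace ℝ (Fin m) :=
  ∑ t ∈ Finset.range T,
    (∑ k, phi (τ k) p (e t - b k)) • (√(T : ℝ))⁻¹ • precondition κ C (x t)

/-- The minimizer of `quadLimit - scoreSum` when all `κ k` are positive and `C` is positive
definite. -/
noncomputable def center (κ : Fin K → ℝ) (C : Matrix (Fin m) (Fin m) ℝ) (p : ℝ)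
    (τ b : Fin K → ℝ) (x : ℕ → EuclideanSpace ℝ (Fin m)) (e : ℕ → ℝ) (T : ℕ) :
    (Fin K → ℝ) × EuclideanSpace ℝ (Fin m) :=
  (fun k => ∑ t ∈ Finset.range T, (κ k)⁻¹ / √(T : ℝ) * phi (τ k) p (e t - b k),
    slopeCenter κ C p τ b x e T)

variable {κ τ b : Fin K → ℝ} {p : ℝ} {C : Matrix (Fin m) (Fin m) ℝ}
  {x : ℕ → EuclideanSpace ℝ (Fin m)}

lemma inner_eq_dotProduct (v w : EuclideanSpace ℝ (Fin m)) :
    inner ℝ v w = v.ofLp ⬝ᵥ w.ofLp := by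
  rw [EuclideanSpace.inner_eq_star_dotProduct, star_trivial, dotProduct_comm]

lemma inner_precondition_left (hC : C.PosDef) (v w : EuclideanSpace ℝ (Fin m)) :
    inner ℝ (precondition κ C v) w = inner ℝ v (precondition κ C w) := by
  have hs : C⁻¹.transpose = C⁻¹ := by
    have := hC.isHermitian.inv.eq
    rwa [Matrix.conjTranspose_eq_transpose_of_trivial] at this
  simp only [inner_eq_dotProduct, precondition, smul_dotProduct, dotProduct_smul]
  rw [Matrix.dotProduct_mulVec, ← Matrix.mulVec_transpose, hs]

lemma precondition_dotProduct_mulVec (hC : C.PosDef) (v w : EuclideanSpace ℝ (Fin m)) :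
    (precondition κ C v).ofLp ⬝ᵥ C.mulVec w.ofLp = (∑ k, κ k)⁻¹ * inner ℝ v w := by
  have hs : C⁻¹.transpose = C⁻¹ := by
    have := hC.isHermitian.inv.eq
    rwa [Matrix.conjTranspose_eq_transpose_of_trivial] at this
  have hdet : IsUnit C.det := (Matrix.isUnit_iff_isUnit_det C).1 hC.isUnit
  simp only [inner_eq_dotProduct, precondition, smul_dotProduct, smul_eq_mul]
  rw [dotProduct_comm, Matrix.dotProduct_mulVec, ← Matrix.mulVec_transpose, hs,
    Matrix.mulVec_mulVec, Matrix.nonsing_inv_mul _ hdet, Matrix.one_mulVec, dotProduct_comm]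

lemma precondition_dotProduct_mulVec_precondition (hC : C.PosDef)
    (ξ : EuclideanSpace ℝ (Fin m)) :
    (precondition κ C ξ).ofLp ⬝ᵥ C.mulVec (precondition κ C ξ).ofLp =
      ((∑ k, κ k) ^ 2)⁻¹ * (ξ.ofLp ⬝ᵥ C⁻¹.mulVec ξ.ofLp) := by
  rw [precondition_dotProduct_mulVec hC, inner_eq_dotProduct, precondition]
  simp only [dotProduct_smul, smul_eq_mul]
  ring

lemma convexOn_finset_sum {E ι : Type*} [AddCommGroup E] [Module ℝ E] (s : Finset ι)
    {f : ι → E → ℝ} (hf : ∀ i ∈ s, ConvexOn ℝ Set.univ (f i)) :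
    ConvexOn ℝ Set.univ fun θ => ∑ i ∈ s, f i θ := by
  refine ⟨convex_univ, fun θ _ θ' _ a a' ha ha' haa => ?_⟩
  simp only [Finset.smul_sum, ← Finset.sum_add_distrib]
  exact Finset.sum_le_sum fun i hi => (hf i hi).2 trivial trivial ha ha' haa

lemma convexOn_remainderSum (hp1 : 1 < p) (hτ0 : ∀ k, 0 < τ k) (hτ1 : ∀ k, τ k < 1)
    (e : ℕ → ℝ) (T : ℕ) : ConvexOn ℝ Set.univ (remainderSum p τ b x e T) := by
  refine convexOn_finset_sum _ fun k _ => convexOn_finset_sum _ fun t _ => ?_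
  have h := (convexOn_remainder (hτ0 k) (hτ1 k) hp1 (e t - b k)).comp_linearMap
    ((√(T : ℝ))⁻¹ • localShift x t k)
  refine h.congr fun θ _ => ?_
  simp only [Function.comp_apply, LinearMap.smul_apply, smul_eq_mul]
  rw [inv_mul_eq_div]

lemma remainderSum_nonneg (hp1 : 1 < p) (hτ0 : ∀ k, 0 < τ k) (hτ1 : ∀ k, τ k < 1)
    (e : ℕ → ℝ) (T : ℕ) (θ : (Fin K → ℝ) × EuclideanSpace ℝ (Fin m)) :
    0 ≤ remainderSum p τ b x e T θ :=
  Finset.sum_nonneg fun k _ => Finset.sum_nonneg fun _ _ =>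
    remainder_nonneg (hτ0 k) (hτ1 k) hp1 _ _

lemma scoreSum_add_smul (e : ℕ → ℝ) (T : ℕ) (a a' : ℝ)
    (θ θ' : (Fin K → ℝ) × EuclideanSpace ℝ (Fin m)) :
    scoreSum p τ b x e T (a • θ + a' • θ') =
      a * scoreSum p τ b x e T θ + a' * scoreSum p τ b x e T θ' := by
  simp only [scoreSum, Finset.mul_sum, ← Finset.sum_add_distrib, map_add, map_smul, smul_eq_mul]
  refine Finset.sum_congr rfl fun k _ => Finset.sum_congr rfl fun t _ => ?_
  ring

lemma convexOn_remainderSum_sub_scoreSum (hp1 : 1 < p) (hτ0 : ∀ k, 0 < τ k)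
    (hτ1 : ∀ k, τ k < 1) (e : ℕ → ℝ) (T : ℕ) :
    ConvexOn ℝ Set.univ fun θ => remainderSum p τ b x e T θ - scoreSum p τ b x e T θ := by
  refine ⟨convex_univ, fun θ _ θ' _ a a' ha ha' haa => ?_⟩
  have h := (convexOn_remainderSum (b := b) (x := x) hp1 hτ0 hτ1 e T).2 (Set.mem_univ θ)
    (Set.mem_univ θ') ha ha' haa
  simp only [smul_eq_mul, scoreSum_add_smul] at h ⊢
  linarith

lemma objective_eq (e y : ℕ → ℝ) (βstar : EuclideanSpace ℝ (Fin m))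
    (hy : ∀ t, y t = inner ℝ (x t) βstar + e t) (T : ℕ)
    (θ : (Fin K → ℝ) × EuclideanSpace ℝ (Fin m)) :
    objective p τ x y T (b + (√(T : ℝ))⁻¹ • θ.1) (βstar + (√(T : ℝ))⁻¹ • θ.2) =
      ∑ k, ∑ t ∈ Finset.range T, eta (τ k) p (e t - b k) +
        (remainderSum p τ b x e T θ - scoreSum p τ b x e T θ) := by
  simp only [objective, remainderSum, scoreSum, ← Finset.sum_add_distrib, ← Finset.sum_sub_distrib]
  refine Finset.sum_congr rfl fun k _ => Finset.sum_congr rfl fun t _ => ?_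
  have e1 : y t - (b + (√(T : ℝ))⁻¹ • θ.1) k - inner ℝ (x t) (βstar + (√(T : ℝ))⁻¹ • θ.2) =
      e t - b k - localShift x t k θ / √(T : ℝ) := by
    rw [hy, localShift_apply, inner_add_right, inner_smul_right]
    simp only [Pi.add_apply, Pi.smul_apply, smul_eq_mul]
    ring
  rw [e1, remainder]
  ring

/-- The rescaled fit minimizes the localized objective. -/
lemma localObjective_le_of_isCLpQRFit {e y : ℕ → ℝ} {βstar : EuclideanSpace ℝ (Fin m)}
    (hy : ∀ t, y t = inner ℝ (x t) βstar + e t) {T : ℕ} (hT : 0 < T) {b' : Fin K → ℝ}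
    {β : EuclideanSpace ℝ (Fin m)} (hfit : IsCLpQRFit p τ x y T b' β)
    (θ : (Fin K → ℝ) × EuclideanSpace ℝ (Fin m)) :
    remainderSum p τ b x e T (√(T : ℝ) • (b' - b), √(T : ℝ) • (β - βstar)) -
        scoreSum p τ b x e T (√(T : ℝ) • (b' - b), √(T : ℝ) • (β - βstar)) ≤
      remainderSum p τ b x e T θ - scoreSum p τ b x e T θ := by
  have hsq : √(T : ℝ) ≠ 0 := by positivity
  have h := hfit (b + (√(T : ℝ))⁻¹ • θ.1) (βstar + (√(T : ℝ))⁻¹ • θ.2)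
  have h2 := objective_eq (p := p) (τ := τ) (b := b) e y βstar hy T
    (√(T : ℝ) • (b' - b), √(T : ℝ) • (β - βstar))
  simp only [inv_smul_smul₀ hsq, add_sub_cancel] at h2
  rw [h2, objective_eq e y βstar hy] at h
  linarith

/-- Completing the square: `quadLimit - scoreSum` is a translate of `quadLimit` up to a constant. -/
lemma quadLimit_sub_scoreSum_center_add (hC : C.PosDef) (hκ : ∀ k, κ k ≠ 0)
    (hκs : ∑ k, κ k ≠ 0) (e : ℕ → ℝ) (T : ℕ) (w : (Fin K → ℝ) × EuclideanSpace ℝ (Fin m)) :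
    quadLimit κ C (center κ C p τ b x e T + w) -
        scoreSum p τ b x e T (center κ C p τ b x e T + w) =
      quadLimit κ C (center κ C p τ b x e T) - scoreSum p τ b x e T (center κ C p τ b x e T) +
        quadLimit κ C w := by
  set θ := center κ C p τ b x e T with hθ
  have hlin := scoreSum_add_smul (p := p) (τ := τ) (b := b) (x := x) e T 1 1 θ w
  simp only [one_smul, one_mul] at hlin
  have hsymm : w.2.ofLp ⬝ᵥ C.mulVec θ.2.ofLp = θ.2.ofLp ⬝ᵥ C.mulVec w.2.ofLp := by
    have hs : C.transpose = C := by
      have := hC.isHermitian.eq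
      rwa [Matrix.conjTranspose_eq_transpose_of_trivial] at this
    rw [Matrix.dotProduct_mulVec, ← Matrix.mulVec_transpose, hs, dotProduct_comm]
  have hquad : quadLimit κ C (θ + w) = quadLimit κ C θ + quadLimit κ C w +
      (∑ k, κ k * (θ.1 k * w.1 k) + (∑ k, κ k) * (θ.2.ofLp ⬝ᵥ C.mulVec w.2.ofLp)) := by
    simp only [quadLimit, Finset.sum_mul, ← Finset.sum_add_distrib]
    refine Finset.sum_congr rfl fun k _ => ?_
    simp only [Prod.fst_add, Prod.snd_add, Pi.add_apply, WithLp.ofLp_add, Matrix.mulVec_add,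
      add_dotProduct, dotProduct_add, hsymm]
    ring
  have h1 : ∑ k, κ k * (θ.1 k * w.1 k) =
      ∑ k, ∑ t ∈ Finset.range T, phi (τ k) p (e t - b k) * (w.1 k / √(T : ℝ)) := by
    refine Finset.sum_congr rfl fun k _ => ?_
    simp only [hθ, center, Finset.sum_mul, Finset.mul_sum]
    refine Finset.sum_congr rfl fun t _ => ?_
    have := hκ k
    field_simp
  have h2 : (∑ k, κ k) * (θ.2.ofLp ⬝ᵥ C.mulVec w.2.ofLp) =
      ∑ k, ∑ t ∈ Finset.range T,
        phi (τ k) p (e t - b k) * (inner ℝ (x t) w.2 / √(T : ℝ)) := by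
    rw [Finset.sum_comm]
    simp only [hθ, center, slopeCenter, WithLp.ofLp_sum, WithLp.ofLp_smul, sum_dotProduct,
      smul_dotProduct, precondition_dotProduct_mulVec hC, Finset.mul_sum, smul_eq_mul,
      ← Finset.sum_mul]
    refine Finset.sum_congr rfl fun t _ => ?_
    field_simp
  have h3 : scoreSum p τ b x e T w =
      ∑ k, κ k * (θ.1 k * w.1 k) + (∑ k, κ k) * (θ.2.ofLp ⬝ᵥ C.mulVec w.2.ofLp) := by
    rw [h1, h2]
    simp only [scoreSum, ← Finset.sum_add_distrib]
    refine Finset.sum_congr rfl fun k _ => Finset.sum_congr rfl fun t _ => ?_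
    rw [localShift_apply]
    ring
  rw [hlin, hquad, h3]
  ring

lemma continuous_quadLimit (κ : Fin K → ℝ) (C : Matrix (Fin m) (Fin m) ℝ) :
    Continuous (quadLimit κ C) := by
  unfold quadLimit
  fun_prop

lemma quadLimit_pos (hC : C.PosDef) (hK : 0 < K) (hκ : ∀ k, 0 < κ k)
    {w : (Fin K → ℝ) × EuclideanSpace ℝ (Fin m)} (hw : w ≠ 0) : 0 < quadLimit κ C w := by
  have hnn : 0 ≤ w.2.ofLp ⬝ᵥ C.mulVec w.2.ofLp := by
    simpa using hC.posSemidef.dotProduct_mulVec_nonneg w.2.ofLp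
  have hk : ∀ k, 0 ≤ κ k / 2 * (w.1 k ^ 2 + w.2.ofLp ⬝ᵥ C.mulVec w.2.ofLp) := fun k => by
    have := hκ k
    positivity
  rw [quadLimit]
  obtain h | h : w.1 ≠ 0 ∨ w.2 ≠ 0 := by
    by_contra! h
    exact hw (Prod.ext h.1 h.2)
  · obtain ⟨k, hk1⟩ := Function.ne_iff.1 h
    refine Finset.sum_pos' (fun k _ => hk k) ⟨k, Finset.mem_univ _, ?_⟩
    have := hκ k
    have hk1 : w.1 k ≠ 0 := hk1
    positivity
  · refine Finset.sum_pos' (fun k _ => hk k) ⟨⟨0, hK⟩, Finset.mem_univ _, ?_⟩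
    have := hκ ⟨0, hK⟩
    have h2 : w.2.ofLp ≠ 0 := fun h' => h (by ext i; simpa using congrFun h' i)
    have h3 : 0 < w.2.ofLp ⬝ᵥ C.mulVec w.2.ofLp := by
      simpa using hC.dotProduct_mulVec_pos h2
    positivity

lemma exists_pos_le_quadLimit (hC : C.PosDef) (hK : 0 < K) (hκ : ∀ k, 0 < κ k) {δ : ℝ}
    (hδ : 0 < δ) : ∃ c, 0 < c ∧ ∀ w : (Fin K → ℝ) × EuclideanSpace ℝ (Fin m), ‖w‖ = δ →
      c ≤ quadLimit κ C w := by
  have hne : (Metric.sphere (0 : (Fin K → ℝ) × EuclideanSpace ℝ (Fin m)) δ).Nonempty := by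
    have : Nonempty (Fin K) := ⟨⟨0, hK⟩⟩
    exact NormedSpace.sphere_nonempty.2 hδ.le
  obtain ⟨w, hw, hmin⟩ := (isCompact_sphere _ _).exists_isMinOn hne
    (continuous_quadLimit κ C).continuousOn
  refine ⟨_, quadLimit_pos hC hK hκ (w := w) ?_, fun w' hw' => hmin (by simpa using hw')⟩
  rintro rfl
  simp at hw
  exact hδ.ne hw

end Local

/-! ### Stochastic limits of the localized objective -/

section Stochastic

variable {Ω : Type*} [MeasurableSpace Ω] {P : Measure Ω} [IsProbabilityMeasure P]
  {ν : Measure ℝ} [IsProbabilityMeasure ν] {ε : ℕ → Ω → ℝ}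

/-- Law of large numbers for the remainders: the means converge by the expansion of the expected
loss, and the variances are at most a sum of terms `|h| ^ (2 p)`, which are negligible relative to
`h ^ 2` as `p > 1`. -/
lemma tendsto_measureReal_sum_remainder (hlaw : ∀ t, HasLaw (ε t) ν P) (hindep : iIndepFun ε P)
    {τ p b : ℝ} (h0 : 0 < τ) (h1 : τ < 1) (hp1 : 1 < p) (hp2 : p ≤ 2)
    (hint : Integrable (fun s => |s - b| ^ (p - 2)) ν)
    (hatom : ν {b} = 0 ∨ (p = 2 ∧ τ = 1 / 2)) {c : ℕ → ℝ} {L : ℝ}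
    (hc : Tendsto (fun T : ℕ => (T : ℝ)⁻¹ * ∑ t ∈ Finset.range T, c t ^ 2) atTop (𝓝 L))
    {η : ℝ} (hη : 0 < η) :
    Tendsto (fun T : ℕ => P.real {ω | η ≤ |∑ t ∈ Finset.range T,
      remainder τ p (ε t ω - b) (c t / √(T : ℝ)) - (∫ s, psi τ p (s - b) ∂ν) / 2 * L|})
      atTop (𝓝 0) := by
  have hmean := tendsto_sum_of_tendsto_div_sq hc (f := fun h => ∫ s, remainder τ p (s - b) h ∂ν)
    (by simp [remainder_zero]) (tendsto_integral_remainder_div_sq h0 h1 hp1 hp2 hint hatom)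
  have hm : ∀ h, Measurable fun s => remainder τ p (s - b) h := fun h =>
    (measurable_remainder h0 h1 hp1 h).comp (measurable_id.sub_const b)
  have hbd : ∀ s h, |remainder τ p s h| ≤ 2 * p * |h| ^ p := fun s h => by
    rw [abs_of_nonneg (remainder_nonneg h0 h1 hp1 _ _)]
    exact remainder_le h0 h1 hp1 hp2 s h
  have hL2 : ∀ h, MemLp (fun s => remainder τ p (s - b) h) 2 ν := fun h =>
    MemLp.of_bound (hm h).aestronglyMeasurable (2 * p * |h| ^ p)
      (Eventually.of_forall fun s => hbd _ _)
  have hlittle : (fun h : ℝ => (2 * p * |h| ^ p) ^ 2) =o[𝓝 0] fun h => h ^ 2 := by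
    have h := hasDerivAt_iff_isLittleO_nhds_zero.1 (hasDerivAt_abs_rpow 0 hp1)
    simp only [zero_add, abs_zero, Real.zero_rpow (by linarith : p ≠ 0), mul_zero, smul_zero,
      sub_zero] at h
    exact (h.const_mul_left (2 * p)).pow two_pos
  have hvar := tendsto_sum_norm_of_isLittleO_sq hc hlittle
  have hvar2 := hvar.div_const ((η / 2) ^ 2)
  rw [zero_div] at hvar2
  refine squeeze_zero' (Eventually.of_forall fun T => measureReal_nonneg) ?_ hvar2
  filter_upwards [Metric.tendsto_nhds.1 hmean (η / 2) (half_pos hη)] with T hT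
  rw [Real.dist_eq] at hT
  refine (measureReal_mono fun ω (hω : η ≤ _) => ?_).trans
    ((measureReal_le_abs_sum_sub_le hlaw hindep
      (g := fun t s => remainder τ p (s - b) (c t / √(T : ℝ))) (fun t => hm _) (fun t => hL2 _) T
      (half_pos hη)).trans ?_)
  · rw [Set.mem_ofPred_eq]
    have := abs_sub_le (∑ t ∈ Finset.range T, remainder τ p (ε t ω - b) (c t / √(T : ℝ)))
      (∑ t ∈ Finset.range T, ∫ s, remainder τ p (s - b) (c t / √(T : ℝ)) ∂ν)
      ((∫ s, psi τ p (s - b) ∂ν) / 2 * L)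
    linarith
  · gcongr with t ht
    rw [Real.norm_of_nonneg (sq_nonneg _)]
    have hle := integral_mono (hL2 (c t / √(T : ℝ))).integrable_sq
      (integrable_const ((2 * p * |c t / √(T : ℝ)| ^ p) ^ 2))
      fun s => sq_le_sq' (neg_le_of_abs_le (hbd (s - b) _)) (le_of_abs_le (hbd (s - b) _))
    simpa using hle

variable {m K : ℕ} {p : ℝ} {τ b : Fin K → ℝ} {x : ℕ → EuclideanSpace ℝ (Fin m)}
  {C : Matrix (Fin m) (Fin m) ℝ}

lemma tendsto_measureReal_remainderSum (hlaw : ∀ t, HasLaw (ε t) ν P) (hindep : iIndepFun ε P)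
    (hK : 0 < K) (hp1 : 1 < p) (hp2 : p ≤ 2) (hτ0 : ∀ k, 0 < τ k) (hτ1 : ∀ k, τ k < 1)
    (hint : ∀ k, Integrable (fun s => |s - b k| ^ (p - 2)) ν)
    (hatom : ∀ k, ν {b k} = 0 ∨ (p = 2 ∧ τ k = 1 / 2))
    (hx : Tendsto (fun T : ℕ => (T : ℝ)⁻¹ • ∑ t ∈ Finset.range T, x t) atTop (𝓝 0))
    (hXC : Tendsto (fun T : ℕ => (T : ℝ)⁻¹ •
      ((designMatrix x T).transpose * designMatrix x T)) atTop (𝓝 C))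
    (θ : (Fin K → ℝ) × EuclideanSpace ℝ (Fin m)) {η : ℝ} (hη : 0 < η) :
    Tendsto (fun T : ℕ => P.real {ω | η ≤ |remainderSum p τ b x (fun t => ε t ω) T θ -
      quadLimit (fun k => ∫ s, psi (τ k) p (s - b k) ∂ν) C θ|}) atTop (𝓝 0) := by
  have hKpos : (0 : ℝ) < K := by exact_mod_cast hK
  have h := fun k => tendsto_measureReal_sum_remainder hlaw hindep
    (hτ0 k) (hτ1 k) hp1 hp2 (hint k) (hatom k) (tendsto_average_sq hx hXC (θ.1 k) θ.2)
    (by positivity : 0 < η / K)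
  have hsum := tendsto_finsetSum Finset.univ fun k _ => h k
  rw [Finset.sum_const_zero] at hsum
  refine squeeze_zero (fun T => measureReal_nonneg) (fun T => ?_) hsum
  refine (measureReal_mono fun ω (hω : η ≤ _) => ?_).trans (measureReal_iUnion_fintype_le _)
  rw [Set.mem_iUnion]
  by_contra! hcon
  simp only [Set.mem_ofPred_eq, not_le] at hcon
  refine absurd hω (not_le.2 ?_)
  rw [remainderSum, quadLimit, ← Finset.sum_sub_distrib]
  have : Nonempty (Fin K) := ⟨⟨0, hK⟩⟩
  calc _ ≤ ∑ k, _ := Finset.abs_sum_le_sum_abs _ _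
    _ < ∑ _k : Fin K, η / K := Finset.sum_lt_sum_of_nonempty Finset.univ_nonempty fun k _ => hcon k
    _ = η := by rw [Finset.sum_const, Finset.card_univ, Fintype.card_fin, nsmul_eq_mul]; field_simp

/-- A random vector dominated by a finite sum of random variables bounded in probability is bounded
in probability. -/
lemma exists_forall_measureReal_norm_le {ι E : Type*} [Fintype ι]
    [NormedAddCommGroup E]
    {X : ι → ℕ → Ω → ℝ} {Y : ℕ → Ω → E} (hY : ∀ T ω, ‖Y T ω‖ ≤ ∑ i, |X i T ω|)
    (hX : ∀ i, ∀ α : ℝ, 0 < α → ∃ M : ℝ, ∀ᶠ T : ℕ in atTop,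
      P.real {ω | M ≤ |X i T ω|} ≤ α)
    {α : ℝ} (hα : 0 < α) :
    ∃ M : ℝ, ∀ᶠ T : ℕ in atTop, P.real {ω | M < ‖Y T ω‖} ≤ α := by
  choose M hM using fun i => hX i (α / (Fintype.card ι + 1)) (by positivity)
  refine ⟨∑ i, M i, ?_⟩
  filter_upwards [eventually_all.2 hM] with T hT
  refine (measureReal_mono (s₂ := ⋃ i, {ω | M i ≤ |X i T ω|}) fun ω (hω : ∑ i, M i < _) => ?_).trans
    ((measureReal_iUnion_fintype_le _).trans ((Finset.sum_le_sum fun i _ => hT i).trans ?_))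
  · rw [Set.mem_iUnion]
    by_contra! hcon
    simp only [Set.mem_ofPred_eq, not_le] at hcon
    exact absurd (hω.trans_le (hY T ω)) (not_lt.2 (Finset.sum_le_sum fun i _ => (hcon i).le))
  · rw [Finset.sum_const, Finset.card_univ, nsmul_eq_mul, mul_div_assoc',
      div_le_iff₀ (by positivity)]
    nlinarith

lemma norm_center_le (κ : Fin K → ℝ) (C : Matrix (Fin m) (Fin m) ℝ) (p : ℝ) (τ b : Fin K → ℝ)
    (x : ℕ → EuclideanSpace ℝ (Fin m)) (e : ℕ → ℝ) (T : ℕ) :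
    ‖center κ C p τ b x e T‖ ≤ ∑ k, |(center κ C p τ b x e T).1 k| +
      ∑ j, |(slopeCenter κ C p τ b x e T).ofLp j| := by
  rw [Prod.norm_def]
  have h1 : ‖(center κ C p τ b x e T).1‖ ≤ ∑ k, |(center κ C p τ b x e T).1 k| :=
    (pi_norm_le_iff_of_nonneg (Finset.sum_nonneg fun _ _ => abs_nonneg _)).2 fun k =>
      Finset.single_le_sum (f := fun k => |(center κ C p τ b x e T).1 k|)
        (fun _ _ => abs_nonneg _) (Finset.mem_univ k)
  have h2 : ‖slopeCenter κ C p τ b x e T‖ ≤ ∑ j, |(slopeCenter κ C p τ b x e T).ofLp j| := by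
    set v := slopeCenter κ C p τ b x e T
    rw [EuclideanSpace.norm_eq]
    refine Real.sqrt_le_iff.2 ⟨Finset.sum_nonneg fun _ _ => abs_nonneg _, ?_⟩
    exact Finset.sum_sq_le_sq_sum_of_nonneg fun _ _ => abs_nonneg _
  have h3 : 0 ≤ ∑ k, |(center κ C p τ b x e T).1 k| := Finset.sum_nonneg fun _ _ => abs_nonneg _
  have h4 : 0 ≤ ∑ j, |(slopeCenter κ C p τ b x e T).ofLp j| :=
    Finset.sum_nonneg fun _ _ => abs_nonneg _
  exact max_le (h1.trans (by linarith)) (h2.trans (by linarith))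

lemma slopeCenter_apply (hC : C.PosDef) (κ : Fin K → ℝ) (e : ℕ → ℝ) (T : ℕ) (j : Fin m) :
    (slopeCenter κ C p τ b x e T).ofLp j = ∑ t ∈ Finset.range T,
      inner ℝ (x t) (precondition κ C (EuclideanSpace.single j 1)) / √(T : ℝ) *
        ∑ k, phi (τ k) p (e t - b k) := by
  simp only [slopeCenter, WithLp.ofLp_sum, WithLp.ofLp_smul, Finset.sum_apply, Pi.smul_apply,
    smul_eq_mul, ← inner_precondition_left hC]
  refine Finset.sum_congr rfl fun t _ => ?_
  rw [EuclideanSpace.inner_single_right]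
  simp
  ring

section Score

variable (hp1 : 1 < p) (hp2 : p ≤ 2) (hτ0 : ∀ k, 0 < τ k) (hτ1 : ∀ k, τ k < 1)
  (hmoment : Integrable (fun s : ℝ => |s| ^ (2 * (p - 1))) ν)
  (hb : ∀ k, IsLpQuantile ν p (τ k) (b k))

include hp1 hτ0 hτ1 in
omit [IsProbabilityMeasure ν] in
lemma measurable_sum_phi : Measurable fun s => ∑ k, phi (τ k) p (s - b k) :=
  Finset.measurable_sum _ fun k _ =>
    (measurable_phi (hτ0 k) (hτ1 k) hp1).comp (measurable_id.sub_const _)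

include hp1 hp2 hτ0 hτ1 hmoment

lemma memLp_sum_phi : MemLp (fun s => ∑ k, phi (τ k) p (s - b k)) 2 ν :=
  memLp_finsetSum _ fun k _ => memLp_phi (hτ0 k) (hτ1 k) hp1 hp2 hmoment (b k)

lemma integrable_phi_mul_phi (k' k : Fin K) :
    Integrable (fun s => phi (τ k') p (s - b k') * phi (τ k) p (s - b k)) ν :=
  (memLp_phi (hτ0 k') (hτ1 k') hp1 hp2 hmoment (b k')).integrable_mul
    (memLp_phi (hτ0 k) (hτ1 k) hp1 hp2 hmoment (b k))

lemma scoreVar_eq : scoreVar ν p τ b = ∫ s, (∑ k, phi (τ k) p (s - b k)) ^ 2 ∂ν := by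
  have h := integrable_phi_mul_phi (b := b) hp1 hp2 hτ0 hτ1 hmoment
  simp_rw [sq, Finset.sum_mul_sum]
  rw [integral_finsetSum _ fun k' _ => integrable_finsetSum _ fun k _ => h k' k]
  refine Finset.sum_congr rfl fun k' _ => ?_
  rw [integral_finsetSum _ fun k _ => h k' k]

include hb

lemma integral_sum_phi_eq_zero : ∫ s, ∑ k, phi (τ k) p (s - b k) ∂ν = 0 := by
  rw [integral_finsetSum _ fun k _ =>
    (memLp_phi (hτ0 k) (hτ1 k) hp1 hp2 hmoment (b k)).integrable (by norm_num)]
  exact Finset.sum_eq_zero fun k _ =>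
    integral_phi_eq_zero (hτ0 k) (hτ1 k) hp1 hp2 hmoment (hb k)

/-- The random minimizer `center` is bounded in probability. -/
lemma exists_forall_measureReal_center_le (hlaw : ∀ t, HasLaw (ε t) ν P)
    (hindep : iIndepFun ε P) (hC : C.PosDef)
    (hx : Tendsto (fun T : ℕ => (T : ℝ)⁻¹ • ∑ t ∈ Finset.range T, x t) atTop (𝓝 0))
    (hXC : Tendsto (fun T : ℕ => (T : ℝ)⁻¹ •
      ((designMatrix x T).transpose * designMatrix x T)) atTop (𝓝 C))
    (κ : Fin K → ℝ) {α : ℝ} (hα : 0 < α) :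
    ∃ M : ℝ, ∀ᶠ T : ℕ in atTop,
      P.real {ω | M < ‖center κ C p τ b x (fun t => ε t ω) T‖} ≤ α := by
  refine exists_forall_measureReal_norm_le (ι := Fin K ⊕ Fin m)
    (X := fun i T ω => Sum.elim (fun k => (center κ C p τ b x (fun t => ε t ω) T).1 k)
      (fun j => (slopeCenter κ C p τ b x (fun t => ε t ω) T).ofLp j) i) (fun T ω => ?_) ?_ hα
  · rw [Fintype.sum_sum_type]
    exact norm_center_le κ C p τ b x _ T
  · rintro (k | j) α hα
    · refine exists_forall_measureReal_le (L := (κ k)⁻¹ ^ 2) (c := fun _ => (κ k)⁻¹) hlaw hindep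
        ((measurable_phi (hτ0 k) (hτ1 k) hp1).comp (measurable_id.sub_const (b k)))
        (memLp_phi (hτ0 k) (hτ1 k) hp1 hp2 hmoment (b k))
        (integral_phi_eq_zero (hτ0 k) (hτ1 k) hp1 hp2 hmoment (hb k)) ?_ hα
      refine tendsto_const_nhds.congr' ?_
      filter_upwards [eventually_gt_atTop 0] with T hT
      have : (T : ℝ) ≠ 0 := by positivity
      rw [Finset.sum_const, Finset.card_range, nsmul_eq_mul, inv_mul_cancel_left₀ this]
    · simp only [Sum.elim_inr, slopeCenter_apply hC]
      have hav := tendsto_average_sq hx hXC 0 (precondition κ C (EuclideanSpace.single j 1))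
      simp only [zero_add] at hav
      exact exists_forall_measureReal_le hlaw hindep
        (measurable_sum_phi hp1 hτ0 hτ1) (memLp_sum_phi hp1 hp2 hτ0 hτ1 hmoment)
        (integral_sum_phi_eq_zero hp1 hp2 hτ0 hτ1 hmoment hb) hav hα

omit hb in
lemma posSemidef_asympCov (hC : C.PosDef) : (asympCov C ν p τ b).PosSemidef := by
  refine hC.inv.posSemidef.smul (div_nonneg ?_ (sq_nonneg _))
  rw [scoreVar_eq hp1 hp2 hτ0 hτ1 hmoment]
  exact integral_nonneg fun _ => sq_nonneg _

lemma tendstoInDistribution_slopeCenter (hlaw : ∀ t, HasLaw (ε t) ν P)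
    (hindep : iIndepFun ε P) (hC : C.PosDef)
    (hx : Tendsto (fun T : ℕ => (T : ℝ)⁻¹ • ∑ t ∈ Finset.range T, x t) atTop (𝓝 0))
    (hXC : Tendsto (fun T : ℕ => (T : ℝ)⁻¹ •
      ((designMatrix x T).transpose * designMatrix x T)) atTop (𝓝 C)) :
    TendstoInDistribution (fun (T : ℕ) ω => slopeCenter
      (fun k => ∫ s, psi (τ k) p (s - b k) ∂ν) C p τ b x (fun t => ε t ω) T) atTop id (fun _ => P)
      (multivariateGaussian 0 (asympCov C ν p τ b)) where
  forall_aemeasurable T := by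
    unfold slopeCenter
    exact Finset.aemeasurable_fun_sum _ fun t _ =>
      ((measurable_sum_phi hp1 hτ0 hτ1).comp_aemeasurable (hlaw t).aemeasurable).smul_const _
  tendsto := by
    refine ProbabilityMeasure.tendsto_iff_tendsto_charFun.2 fun ξ => ?_
    simp only [ProbabilityMeasure.coe_mk, Measure.map_id]
    rw [charFun_multivariateGaussian (posSemidef_asympCov hp1 hp2 hτ0 hτ1 hmoment hC)]
    have hav := tendsto_average_sq hx hXC 0
      (precondition (fun k => ∫ s, psi (τ k) p (s - b k) ∂ν) C ξ)
    simp only [zero_add, ← inner_precondition_left hC] at hav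
    have h := tendsto_charFun_weighted_sum hlaw hindep (measurable_sum_phi hp1 hτ0 hτ1)
      (memLp_sum_phi hp1 hp2 hτ0 hτ1 hmoment)
      (integral_sum_phi_eq_zero hp1 hp2 hτ0 hτ1 hmoment hb) _ ξ hav
    rw [precondition_dotProduct_mulVec_precondition hC,
      ← scoreVar_eq hp1 hp2 hτ0 hτ1 hmoment] at h
    refine h.trans (le_of_eq ?_)
    congr 2
    simp only [asympCov, curvature, Matrix.smul_mulVec, dotProduct_smul, smul_eq_mul,
      inner_zero_right]
    push_cast
    ring_nf

end Score

end Stochastic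

end CLpQR

open CLpQR in
theorem theorem2p1 {Ω : Type*} [MeasurableSpace Ω] (P : Measure Ω) [IsProbabilityMeasure P]
    {m K : ℕ} (hK : 0 < K) (p : ℝ) (hp1 : 1 < p) (hp2 : p ≤ 2)
    -- the weights `0 < τ₁ < ⋯ < τ_K < 1`
    (τ : Fin K → ℝ) (hτ : StrictMono τ) (hτ0 : ∀ k, 0 < τ k) (hτ1 : ∀ k, τ k < 1)
    -- the law of the error and its `L^p`-quantiles
    (ν : Measure ℝ) [IsProbabilityMeasure ν]
    (bstar : Fin K → ℝ) (hb : ∀ k, CLpQR.IsLpQuantile ν p (τ k) (bstar k))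
    -- the linear model with i.i.d. errors and asymptotically centered predictors
    (x : ℕ → EuclideanSpace ℝ (Fin m)) (βstar : EuclideanSpace ℝ (Fin m))
    (ε y : ℕ → Ω → ℝ)
    (hε_law : ∀ t, HasLaw (ε t) ν P) (hε_indep : iIndepFun ε P)
    (hy : ∀ t ω, y t ω = inner ℝ (x t) βstar + ε t ω)
    (hx : Tendsto (fun T : ℕ => (T : ℝ)⁻¹ • ∑ t ∈ Finset.range T, x t) atTop (𝓝 0))
    -- `(1/T) X'X → C`, positive definite
    (C : Matrix (Fin m) (Fin m) ℝ) (hC : C.PosDef)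
    (hXC : Tendsto (fun T : ℕ => (T : ℝ)⁻¹ •
      ((CLpQR.designMatrix x T).transpose * CLpQR.designMatrix x T)) atTop (𝓝 C))
    -- `E|ε|^{2(p-1)} < ∞`
    (hmoment : Integrable (fun s : ℝ => |s| ^ (2 * (p - 1))) ν)
    -- `E|ε - b|^{p-2} < ∞` for `b` near each quantile; the integrand is `∞` at `ε = b` if `p < 2`
    (hlocal : ∃ δ : ℝ, 0 < δ ∧ ∀ k, ∀ b ∈ Metric.ball (bstar k) δ,
      ∫⁻ s, ENNReal.ofReal |s - b| ^ (p - 2) ∂ν < ⊤)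
    -- if `p = 2`, no atom at a quantile of weight other than `1/2` (automatic if `p < 2`)
    (hatom : p = 2 → ∀ k, τ k ≠ 1 / 2 → ν {bstar k} = 0)
    -- the estimators
    (bhat : ℕ → Ω → Fin K → ℝ) (βhat : ℕ → Ω → EuclideanSpace ℝ (Fin m))
    (hβhat : ∀ T, AEMeasurable (βhat T) P)
    (hfit : ∀ T, ∀ᵐ ω ∂P,
      CLpQR.IsCLpQRFit p τ x (fun t => y t ω) T (bhat T ω) (βhat T ω)) :
    (∀ k' k, Integrable (fun s => CLpQR.phi (τ k') p (s - bstar k') *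
        CLpQR.phi (τ k) p (s - bstar k)) ν) ∧
    (∀ k, Integrable (fun s => CLpQR.psi (τ k) p (s - bstar k)) ν) ∧
    0 < CLpQR.curvature ν p τ bstar ∧
    (CLpQR.asympCov C ν p τ bstar).PosSemidef ∧
    TendstoInDistribution (fun (T : ℕ) ω => √(T : ℝ) • (βhat T ω - βstar)) atTop id (fun _ => P)
      (multivariateGaussian 0 (CLpQR.asympCov C ν p τ bstar)) := by
  obtain ⟨δ₀, hδ₀, hfin⟩ := hlocal
  have hfin : ∀ k, ∫⁻ s, ENNReal.ofReal |s - bstar k| ^ (p - 2) ∂ν < ⊤ := fun k =>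
    hfin k _ (Metric.mem_ball_self hδ₀)
  have hint : ∀ k, Integrable (fun s => |s - bstar k| ^ (p - 2)) ν := fun k =>
    integrable_abs_rpow_sub hp2 (hfin k)
  have hat : ∀ k, ν {bstar k} = 0 ∨ (p = 2 ∧ τ k = 1 / 2) := fun k => by
    rcases hp2.lt_or_eq with h | h
    · exact Or.inl (measure_singleton_eq_zero h (hfin k))
    · by_cases hk : τ k = 1 / 2
      · exact Or.inr ⟨h, hk⟩
      · exact Or.inl (hatom h k hk)
  have hκ : ∀ k, 0 < ∫ s, psi (τ k) p (s - bstar k) ∂ν := fun k =>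
    integral_psi_pos (hτ0 k) (hτ1 k) hp1 (hint k) ((hat k).elim Or.inr fun h => Or.inl h.1)
  have hcurv : 0 < curvature ν p τ bstar :=
    Finset.sum_pos (fun k _ => hκ k) ⟨⟨0, hK⟩, Finset.mem_univ _⟩
  refine ⟨integrable_phi_mul_phi hp1 hp2 hτ0 hτ1 hmoment,
    fun k => integrable_psi (hτ0 k) (hτ1 k) hp1 (hint k), hcurv,
    posSemidef_asympCov hp1 hp2 hτ0 hτ1 hmoment hC, ?_⟩
  set κ : Fin K → ℝ := fun k => ∫ s, psi (τ k) p (s - bstar k) ∂ν with hκdef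
  refine tendstoInDistribution_of_tendstoInMeasure_sub _ _
    (tendstoInDistribution_slopeCenter hp1 hp2 hτ0 hτ1 hmoment hb hε_law hε_indep hC hx hXC) ?_
    fun T => ((hβhat T).sub_const βstar).const_smul √(T : ℝ)
  rw [tendstoInMeasure_iff_measureReal_norm]
  intro δ hδ
  simp only [Pi.sub_apply, Pi.zero_apply, sub_zero, ← hκdef]
  rw [Metric.tendsto_nhds]
  intro α hα
  obtain ⟨M, hM⟩ := exists_forall_measureReal_center_le hp1 hp2 hτ0 hτ1 hmoment hb hε_law hε_indep
    hC hx hXC κ (by positivity : 0 < α / 4)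
  obtain ⟨c, hc, hcq⟩ := exists_pos_le_quadLimit hC hK hκ (half_pos hδ)
  obtain ⟨F, η, hη, hF⟩ := exists_finset_abs_sub_le_of_convexOn (continuous_quadLimit κ C)
    (M + δ / 2) (by positivity : 0 < c / 3)
  have hsum := tendsto_finsetSum F fun θ _ => tendsto_measureReal_remainderSum hε_law hε_indep hK
    hp1 hp2 hτ0 hτ1 hint hat hx hXC θ hη
  rw [Finset.sum_const_zero] at hsum
  filter_upwards [hM, hsum.eventually_le_const (by positivity : 0 < α / 4),
    eventually_gt_atTop 0] with T hMT hsumT hT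
  rw [Real.dist_0_eq_abs, abs_of_nonneg measureReal_nonneg]
  -- off the exceptional events, `remainderSum` is within `c / 3` of `quadLimit` on a ball that
  -- contains the `δ / 2`-ball around `center`, on whose boundary `quadLimit` has grown by `c`
  have hsub : {ω | δ ≤ ‖√(T : ℝ) • (βhat T ω - βstar) -
      slopeCenter κ C p τ bstar x (fun t => ε t ω) T‖} ≤ᵐ[P]
      ({ω | M < ‖center κ C p τ bstar x (fun t => ε t ω) T‖} ∪ ⋃ θ ∈ F,
        {ω | η ≤ |remainderSum p τ bstar x (fun t => ε t ω) T θ - quadLimit κ C θ|} : Set Ω) := by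
    filter_upwards [hfit T] with ω hω hδω
    have hδω : δ ≤ _ := hδω
    by_contra hcon
    have hcon : ω ∉ ({ω | M < ‖center κ C p τ bstar x (fun t => ε t ω) T‖} ∪ ⋃ θ ∈ F,
        {ω | η ≤ |remainderSum p τ bstar x (fun t => ε t ω) T θ - quadLimit κ C θ|} : Set Ω) :=
      hcon
    simp only [Set.mem_union, Set.mem_ofPred_eq, Set.mem_iUnion, not_or, not_lt, not_exists,
      not_le] at hcon
    obtain ⟨hcen, hnet⟩ := hcon
    have hclose := hF _ (convexOn_remainderSum hp1 hτ0 hτ1 (fun t => ε t ω) T)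
      (remainderSum_nonneg hp1 hτ0 hτ1 _ T) fun θ hθ => (hnet θ hθ).le
    set θ₀ := center κ C p τ bstar x (fun t => ε t ω) T with hθ₀
    have hmain := norm_sub_le_of_convexOn_of_isMinOn
      (q := fun θ => quadLimit κ C θ - scoreSum p τ bstar x (fun t => ε t ω) T θ)
      (convexOn_remainderSum_sub_scoreSum (b := bstar) (x := x) hp1 hτ0 hτ1 (fun t => ε t ω) T)
      (θ₀ := θ₀)
      (half_pos hδ) (ε := c / 3) (fun θ hθ => ?_) (fun θ hθ => ?_)
      (localObjective_le_of_isCLpQRFit (b := bstar) (hy · ω) hT hω)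
    · have hsnd := (norm_snd_le _).trans hmain
      have hsnd : ‖√(T : ℝ) • (βhat T ω - βstar) -
        slopeCenter κ C p τ bstar x (fun t => ε t ω) T‖ ≤ δ / 2 := hsnd
      linarith
    · rw [sub_sub_sub_cancel_right]
      refine hclose θ ?_
      rw [mem_closedBall_zero_iff]
      have := norm_le_norm_add_norm_sub' θ θ₀
      linarith
    · have := quadLimit_sub_scoreSum_center_add (p := p) (τ := τ) (b := bstar) (x := x) hC
        (fun k => (hκ k).ne') hcurv.ne' (fun t => ε t ω) T (θ - θ₀)
      rw [← hθ₀, add_sub_cancel] at this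
      rw [this]
      have := hcq _ hθ
      linarith
  have hle : P.real {ω | δ ≤ ‖√(T : ℝ) • (βhat T ω - βstar) -
      slopeCenter κ C p τ bstar x (fun t => ε t ω) T‖} ≤ α / 4 + α / 4 := by
    refine (ENNReal.toReal_mono (measure_ne_top _ _) (measure_mono_ae hsub)).trans ?_
    refine (measureReal_union_le _ _).trans (add_le_add hMT ?_)
    exact (measureReal_biUnion_finset_le _ _).trans hsumT
  linarith
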